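/- \textbf{Setting.} Let $k\ge 2$ and $n_1,\dots,n_k\ge 1$, $p_1,\dots,p_k\geq 0$, and put $n=n_1+\cdots+n_k$. For $1\le j\le k$ let $M_j$ be a closed (compact, connected, without boundary) smooth $n_j$-dimensional manifold and $f_j:M_j\to S^{n_j+p_j}\subset\mathbb R^{n_j+p_j+1}$ a smooth minimal immersion into the unit sphere (orientability of $M_j$ is not needed). Let $M=M_1\times\cdots\times M_k$ and let \[ f=(c_1f_1,\dots,c_kf_k):M\to S^{N}\subset\bigoplus_{j}\mathbb R^{n_j+p_j+1},\qquad N=k-1+\sum_j(n_j+p_j),\] be a \emph{minimal product} of $f_1,\dots,f_k$, that is, $c_j\in\mathbb R\setminus\{0\}$, $\sum_j c_j^2=1$, and $f$ is a minimal immersion into the unit sphere $S^N$. Let $S$ and $S_j$ be the squared lengths of the second fundamental forms of $f$ and $f_j$ in the respective unit spheres, $dM$ and $dM_j$ the volume measures of the induced metrics, and \[\overline S=\frac1{\mathrm{Vol}(f)}\int_M S\,dM,\qquad \overline{S_j}=\frac1{\mathrm{Vol}(f_j)}\int_{M_j}S_j\,dM_j .\] Let $C_{n_1,\dots,n_k}$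 be the Clifford minimal submanifold \[\Bigl(\sqrt{\tfrac{n_1}{n}}\,y_1,\dots,\sqrt{\tfrac{n_k}{n}}\,y_k\Bigr):S^{n_1}\times\cdots\times S^{n_k}\to S^{n+k-1}\subset\bigoplus_j\mathbb R^{n_j+1}.\] \textbf{Theorem.} The volumes are positive and finite, and all functions integrated here are integrable. For every $a\in\mathbb R$, \[\int_M S^a\bigl(S-(k-1)n\bigr)\,dM\ \ge\ 0,\] and \[\overline S=n\Bigl(k-1+\sum_{j=1}^k\frac{\overline{S_j}}{n_j}\Bigr)\ \ge\ (k-1)n .\] For each $a$, equality holds in the first inequality if and only if $f$ is congruent to $C_{n_1,\dots,n_k}$, and equality $\overline S=(k-1)n$ holds if and only if $f$ is congruent to $C_{n_1,\dots,n_k}$. Here congruent means that $f(M)$ is the image of $C_{n_1,\dots,n_k}$ under a linear isometric embedding $A:\bigoplus_j\mathbb R^{n_j+1}\to\bigoplus_j\mathbb R^{n_j+p_j+1}$. If moreover $f_j$ is injective for every $j$ with $n_j=1$, then both equality statements also hold with congruence of immersions, that is, with the condition that $f=A\circ C_{n_1,\dots,n_k}\circ\varphi$ for such an $A$ and a diffeomorphism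 $\varphi:M\to S^{n_1}\times\cdots\times S^{n_k}$. -/

import Mathlib

open scoped Manifold ContDiff

noncomputable section

namespace MinimalProduct

section Immersions

variable {E : Type*} [NormedAddCommGroup E] [NormedSpace ℝ E] [FiniteDimensional ℝ E]
  {H : Type*} [TopologicalSpace H] (I : ModelWithCorners ℝ E H)
  {M : Type*} [TopologicalSpace M] [ChartedSpace H M]
  {V : Type*} [NormedAddCommGroup V] [InnerProductSpace ℝ V] [FiniteDimensional ℝ V]

/-- The map `f : M → V` read in the preferred chart at `x`. -/
def localRep (f : M → V) (x : M) : E → V :=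
  f ∘ (extChartAt I x).symm

/-- The differential of `f` at `x`, read in the preferred chart at `x`
(the tangent space `T_x M` is the model space `E`). -/
def dAt (f : M → V) (x : M) : E →L[ℝ] V :=
  fderiv ℝ (localRep I f x) (extChartAt I x x)

/-- The tangent plane `df(T_x M)`, as a subspace of the ambient vector space `V`. -/
def tangentPlane (f : M → V) (x : M) : Submodule ℝ V :=
  LinearMap.range (dAt I f x : E →ₗ[ℝ] V)

/-- The normal space at `x` of `f` as a map into the unit sphere of `V`: the vectors
orthogonal to the tangent plane and to the position vector `f x`. -/
def normalSpace (f : M → V) (x : M) : Submodule ℝ V :=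
  (tangentPlane I f x ⊔ Submodule.span ℝ {f x})ᗮ

/-- The second fundamental form at `x` of `f` as a map into the unit sphere of `V`: the
component of the second derivative of `f` in the normal space of `f` in the sphere. This normal
component does not depend on the chart in which the second derivative is taken. -/
def secondFundamentalForm (f : M → V) (x : M) (u v : E) : V :=
  (normalSpace I f x).starProjection
    (fderiv ℝ (fderiv ℝ (localRep I f x)) (extChartAt I x x) u v)

/-- A frame of `T_x M` that is orthonormal for the metric induced by the immersion `f`: vectors
which `df` maps to an orthonormal basis of the tangent plane. -/
def orthonormalFrame (f : M → V) (x : M) (i : Fin (Module.finrank ℝ (tangentPlane I f x))) : E :=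
  Function.surjInv (LinearMap.surjective_rangeRestrict (dAt I f x : E →ₗ[ℝ] V))
    (stdOrthonormalBasis ℝ (tangentPlane I f x) i)

/-- The mean curvature vector of `f` in the unit sphere: the trace of the second fundamental
form, divided by the dimension of `M`. -/
def meanCurvature (f : M → V) (x : M) : V :=
  (Module.finrank ℝ E : ℝ)⁻¹ • ∑ i, secondFundamentalForm I f x
    (orthonormalFrame I f x i) (orthonormalFrame I f x i)

/-- `S`, the squared length of the second fundamental form of `f` in the unit sphere. -/
def sqNormSFF (f : M → V) (x : M) : ℝ :=
  ∑ i, ∑ j, ‖secondFundamentalForm I f x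
    (orthonormalFrame I f x i) (orthonormalFrame I f x j)‖ ^ 2

/-- `f : M → V` is a smooth minimal immersion into the unit sphere of `V`. -/
structure IsMinimalInSphere (f : M → V) : Prop where
  contMDiff : ContMDiff I 𝓘(ℝ, V) ∞ f
  mem_sphere : ∀ x, f x ∈ Metric.sphere (0 : V) 1
  immersion : ∀ x, Function.Injective (mfderiv I 𝓘(ℝ, V) f x)
  minimal : ∀ x, meanCurvature I f x = 0

/-- The Riemannian volume measure of the metric induced by `f`, on the domain of the preferred
chart at `x`: in coordinates it is `√(det g) dy`. Here `g` is the Gram matrix of the images under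
`df` of a basis of `E`, and `dy` the Lebesgue measure normalized by the same basis, so that the
choice of the basis is immaterial. -/
def chartVolume [MeasurableSpace E] [BorelSpace E] [MeasurableSpace M]
    (f : M → V) (x : M) : MeasureTheory.Measure M :=
  (((Module.finBasis ℝ E).addHaar.restrict (extChartAt I x).target).withDensity
    (fun y => ENNReal.ofReal (Real.sqrt (Matrix.gram ℝ
      (fun i => fderiv ℝ (localRep I f x) y (Module.finBasis ℝ E i))).det))).map
    (extChartAt I x).symm

/-- The Riemannian volume measure `dM` of the metric induced by `f`. The measures
`chartVolume I f x` agree on overlaps of chart domains, and `dM` is the measure obtained by gluing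
them, which is their supremum. -/
def inducedVolume [MeasurableSpace E] [BorelSpace E] [MeasurableSpace M]
    (f : M → V) : MeasureTheory.Measure M :=
  ⨆ x : M, chartVolume I f x

end Immersions

section Congruence

variable {M N V W : Type*}
  [NormedAddCommGroup V] [InnerProductSpace ℝ V]
  [NormedAddCommGroup W] [InnerProductSpace ℝ W]

/-- The image of `f`, in the unit sphere of `V`, is congruent to the image of `g`, in the unit
sphere of `W`, the latter sphere being regarded as a great subsphere of the former through a
linear isometric embedding. -/
def ImageCongruent (f : M → V) (g : N → W) : Prop :=
  ∃ A : W →ₗᵢ[ℝ] V, Set.range f = A '' Set.range g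

/-- `f` and `g` are congruent as immersions: they agree after a diffeomorphism of the domains
and a linear isometric embedding of the ambient space of `g` into that of `f`. -/
def Congruent {E : Type*} [NormedAddCommGroup E] [NormedSpace ℝ E]
    {E' : Type*} [NormedAddCommGroup E'] [NormedSpace ℝ E']
    {H : Type*} [TopologicalSpace H] (I : ModelWithCorners ℝ E H)
    {H' : Type*} [TopologicalSpace H'] (J : ModelWithCorners ℝ E' H')
    [TopologicalSpace M] [ChartedSpace H M] [TopologicalSpace N] [ChartedSpace H' N]
    (f : M → V) (g : N → W) : Prop :=
  ∃ (A : W →ₗᵢ[ℝ] V) (φ : Diffeomorph I J M N ∞), ∀ x, f x = A (g (φ x))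

end Congruence

/-- The product manifold model `ℝ^{n_1} × ⋯ × ℝ^{n_k}`. -/
abbrev prodModel {k : ℕ} (n : Fin k → ℕ) :
    ModelWithCorners ℝ (∀ j, EuclideanSpace ℝ (Fin (n j)))
      (ModelPi fun j => EuclideanSpace ℝ (Fin (n j))) :=
  ModelWithCorners.pi fun j => 𝓡 (n j)

/-- The product `(c_1 f_1, …, c_k f_k) : M_1 × ⋯ × M_k → V_1 ⊕ ⋯ ⊕ V_k` (orthogonal sum). -/
def productMap {k : ℕ} {M V : Fin k → Type*} [∀ j, NormedAddCommGroup (V j)]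
    [∀ j, InnerProductSpace ℝ (V j)] (c : Fin k → ℝ) (f : ∀ j, M j → V j) :
    (∀ j, M j) → PiLp 2 V :=
  fun x => WithLp.toLp 2 fun j => c j • f j (x j)

/-- `(c_1 f_1, …, c_k f_k)` is a minimal product: the coefficients are non-zero with
`∑ c_j ^ 2 = 1`, and the product is a minimal immersion into the unit sphere. -/
structure IsMinimalProduct {k : ℕ} (n : Fin k → ℕ) {M V : Fin k → Type*}
    [∀ j, TopologicalSpace (M j)] [∀ j, ChartedSpace (EuclideanSpace ℝ (Fin (n j))) (M j)]
    [∀ j, NormedAddCommGroup (V j)] [∀ j, InnerProductSpace ℝ (V j)]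
    [∀ j, FiniteDimensional ℝ (V j)] (c : Fin k → ℝ) (f : ∀ j, M j → V j) : Prop where
  ne_zero : ∀ j, c j ≠ 0
  sum_sq : ∑ j, c j ^ 2 = 1
  minimal : IsMinimalInSphere (prodModel n) (productMap c f)

/-- The Clifford minimal submanifold `C_{n_1,…,n_k}`, i.e.
`(√(n_1/n) S^{n_1}, …, √(n_k/n) S^{n_k})` with `n = n_1 + ⋯ + n_k`. -/
def clifford {k : ℕ} (n : Fin k → ℕ) :
    (∀ j, Metric.sphere (0 : EuclideanSpace ℝ (Fin (n j + 1))) 1) →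
      PiLp 2 (fun j => EuclideanSpace ℝ (Fin (n j + 1))) :=
  productMap (fun j => Real.sqrt ((n j : ℝ) / ((∑ i, n i : ℕ) : ℝ))) (fun _ y => y)

end MinimalProduct

end

open MinimalProduct MeasureTheory

noncomputable section

open scoped Topology ENNReal

set_option linter.unusedSectionVars false

namespace MinimalProduct

section Reproducing

variable {E : Type*} [NormedAddCommGroup E] [NormedSpace ℝ E]
  {V : Type*} [NormedAddCommGroup V] [InnerProductSpace ℝ V]
  {W : Type*} [NormedAddCommGroup W] [InnerProductSpace ℝ W]
  {ι κ : Type*} [Fintype ι] [Fintype κ]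

/-- A family `e` is reproducing for `D` if it is a Parseval frame for the quadratic form that `D`
pulls back from `V`. -/
def IsReproducing (D : E →L[ℝ] V) (e : ι → E) : Prop :=
  ∀ u, ∑ i, inner ℝ (D (e i)) (D u) • e i = u

lemma IsReproducing.sum_bilin_eq {D : E →L[ℝ] V} {e : ι → E} {e' : κ → E}
    (he : IsReproducing D e) (he' : IsReproducing D e') (Q : E →ₗ[ℝ] E →ₗ[ℝ] W) :
    ∑ i, Q (e i) (e i) = ∑ a, Q (e' a) (e' a) := by
  calc ∑ i, Q (e i) (e i)
      = ∑ i, Q (e i) (∑ a, inner ℝ (D (e' a)) (D (e i)) • e' a) := by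
        simp only [he' _]
    _ = ∑ i, ∑ a, inner ℝ (D (e' a)) (D (e i)) • Q (e i) (e' a) := by
        simp only [map_sum, map_smul]
    _ = ∑ a, ∑ i, inner ℝ (D (e' a)) (D (e i)) • Q (e i) (e' a) := Finset.sum_comm
    _ = ∑ a, Q (∑ i, inner ℝ (D (e i)) (D (e' a)) • e i) (e' a) := by
        simp only [map_sum, map_smul, LinearMap.sum_apply, LinearMap.smul_apply]
        simp only [real_inner_comm]
    _ = ∑ a, Q (e' a) (e' a) := by simp only [he _]

/-- The real bilinear form `(u, v) ↦ ⟪A u, B v⟫`. -/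
def innerForm (A B : E →ₗ[ℝ] W) : E →ₗ[ℝ] E →ₗ[ℝ] ℝ :=
  LinearMap.mk₂ ℝ (fun u v => inner ℝ (A u) (B v))
    (fun _ _ _ => by simp [inner_add_left]) (fun _ _ _ => by simp [inner_smul_left])
    (fun _ _ _ => by simp [inner_add_right]) (fun _ _ _ => by simp [inner_smul_right])

lemma IsReproducing.sum_norm_sq_eq {D : E →L[ℝ] V} {e : ι → E} {e' : κ → E}
    (he : IsReproducing D e) (he' : IsReproducing D e') (B : E →L[ℝ] E →L[ℝ] W) :
    ∑ i, ∑ j, ‖B (e i) (e j)‖ ^ 2 = ∑ a, ∑ b, ‖B (e' a) (e' b)‖ ^ 2 := by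
  have h1 (u : E) : ∑ j, ‖B u (e j)‖ ^ 2 = ∑ b, ‖B u (e' b)‖ ^ 2 := by
    simpa [innerForm] using he.sum_bilin_eq he' (innerForm (B u).toLinearMap (B u).toLinearMap)
  have h2 (v : E) : ∑ i, ‖B (e i) v‖ ^ 2 = ∑ a, ‖B (e' a) v‖ ^ 2 := by
    simpa [innerForm] using
      he.sum_bilin_eq he' (innerForm (B.flip v).toLinearMap (B.flip v).toLinearMap)
  simp only [h1]
  rw [Finset.sum_comm]
  simp only [h2]
  rw [Finset.sum_comm]

lemma IsReproducing.comp {E' : Type*} [NormedAddCommGroup E'] [NormedSpace ℝ E']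
    {D : E →L[ℝ] V} {T : E' →L[ℝ] E} {e : ι → E'} (he : IsReproducing (D.comp T) e)
    (hT : Function.Surjective T) : IsReproducing D (fun i => T (e i)) := by
  intro u
  obtain ⟨w, rfl⟩ := hT u
  conv_rhs => rw [← he w]
  simp

end Reproducing

section NormalProjection

variable {E : Type*} [NormedAddCommGroup E] [NormedSpace ℝ E]
  {V : Type*} [NormedAddCommGroup V] [InnerProductSpace ℝ V]

lemma mem_normal_iff {D : E →L[ℝ] V} {q r : V} :
    r ∈ (LinearMap.range (D : E →ₗ[ℝ] V) ⊔ Submodule.span ℝ {q})ᗮ ↔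
      (∀ u, inner ℝ (D u) r = (0 : ℝ)) ∧ inner ℝ q r = (0 : ℝ) := by
  rw [← Submodule.inf_orthogonal, Submodule.mem_inf,
    Submodule.mem_orthogonal_singleton_iff_inner_right, Submodule.mem_orthogonal]
  simp

variable [FiniteDimensional ℝ V]

/-- The orthogonal projection onto the complement of the range of `D` and of the vector `q`. -/
def normalProj (D : E →L[ℝ] V) (q : V) : V →L[ℝ] V :=
  (LinearMap.range (D : E →ₗ[ℝ] V) ⊔ Submodule.span ℝ {q})ᗮ.starProjection

lemma normalProj_eq {D : E →L[ℝ] V} {q v r : V} {w : E} {t : ℝ}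
    (h1 : ∀ u, inner ℝ (D u) r = (0 : ℝ)) (h2 : inner ℝ q r = (0 : ℝ))
    (h : v = D w + r + t • q) : normalProj D q v = r := by
  refine Submodule.eq_starProjection_of_mem_orthogonal' (z := D w + t • q)
    (mem_normal_iff.2 ⟨h1, h2⟩) (Submodule.le_orthogonal_orthogonal _ ?_) (by rw [h]; abel)
  exact Submodule.add_mem_sup (LinearMap.mem_range_self _ w)
    (Submodule.smul_mem _ _ (Submodule.mem_span_singleton_self q))

lemma inner_normalProj (D : E →L[ℝ] V) (q v : V) :
    (∀ u, inner ℝ (D u) (normalProj D q v) = (0 : ℝ)) ∧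
      inner ℝ q (normalProj D q v) = (0 : ℝ) :=
  mem_normal_iff.1 (Submodule.starProjection_apply_mem _ v)

lemma exists_normal_decomposition {D : E →L[ℝ] V} {q : V} (hq : ‖q‖ = 1)
    (hDq : ∀ u, inner ℝ (D u) q = (0 : ℝ)) (v : V) :
    ∃ w, v = D w + normalProj D q v + (inner ℝ q v : ℝ) • q := by
  have h : v - normalProj D q v ∈ LinearMap.range (D : E →ₗ[ℝ] V) ⊔ Submodule.span ℝ {q} := by
    have := Submodule.sub_starProjection_mem_orthogonal
      (K := (LinearMap.range (D : E →ₗ[ℝ] V) ⊔ Submodule.span ℝ {q})ᗮ) v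
    rwa [Submodule.orthogonal_orthogonal] at this
  obtain ⟨a, ⟨w, rfl⟩, b, hb, hab⟩ := Submodule.mem_sup.1 h
  obtain ⟨t, rfl⟩ := Submodule.mem_span_singleton.1 hb
  have hv : v = D w + normalProj D q v + t • q := by
    rw [eq_sub_iff_add_eq, add_right_comm] at hab
    exact hab.symm
  have ht : (inner ℝ q v : ℝ) = t := by
    rw [hv, inner_add_right, inner_add_right, inner_smul_right, real_inner_comm, hDq,
      (inner_normalProj D q v).2, real_inner_self_eq_norm_sq, hq]
    simp
  exact ⟨w, by rw [ht]; exact hv⟩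

end NormalProjection

section Pseudoinverse

variable {E : Type*} [NormedAddCommGroup E] [InnerProductSpace ℝ E] [FiniteDimensional ℝ E]
  {V : Type*} [NormedAddCommGroup V] [InnerProductSpace ℝ V] [FiniteDimensional ℝ V]

/-- The pseudoinverse `(D* D)⁻¹ D*` of an injective linear map. -/
def pinv (D : E →L[ℝ] V) : V →L[ℝ] E :=
  (Ring.inverse ((ContinuousLinearMap.adjoint D).comp D)).comp (ContinuousLinearMap.adjoint D)

lemma isUnit_adjoint_comp_self {D : E →L[ℝ] V} (hD : Function.Injective D) :
    IsUnit ((ContinuousLinearMap.adjoint D).comp D) := by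
  have hinj : Function.Injective ((ContinuousLinearMap.adjoint D).comp D) := by
    rw [injective_iff_map_eq_zero]
    intro u hu
    have : inner ℝ (D u) (D u) = (0 : ℝ) := by
      rw [← ContinuousLinearMap.adjoint_inner_left]
      have : (ContinuousLinearMap.adjoint D) (D u) = 0 := hu
      simp [this]
    exact (injective_iff_map_eq_zero D).1 hD u (inner_self_eq_zero.1 this)
  let e := (LinearEquiv.ofInjectiveEndo
    ((ContinuousLinearMap.adjoint D).comp D).toLinearMap hinj).toContinuousLinearEquiv
  refine ⟨ContinuousLinearEquiv.toUnit e, ?_⟩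
  ext u
  rfl

lemma pinv_comp_self {D : E →L[ℝ] V} (hD : Function.Injective D) (u : E) : pinv D (D u) = u := by
  have := Ring.inverse_mul_cancel _ (isUnit_adjoint_comp_self hD)
  exact DFunLike.congr_fun this u

lemma comp_pinv_inner {D : E →L[ℝ] V} (hD : Function.Injective D) (v : V) (u : E) :
    inner ℝ (D (pinv D v)) (D u) = (inner ℝ v (D u) : ℝ) := by
  have := DFunLike.congr_fun (Ring.mul_inverse_cancel _ (isUnit_adjoint_comp_self hD))
    (ContinuousLinearMap.adjoint D v)
  have h : (ContinuousLinearMap.adjoint D) (D (pinv D v)) = ContinuousLinearMap.adjoint D v := this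
  rw [← ContinuousLinearMap.adjoint_inner_left, h, ContinuousLinearMap.adjoint_inner_left]

lemma isReproducing_pinv {D : E →L[ℝ] V} (hD : Function.Injective D) :
    IsReproducing D (fun a => pinv D (stdOrthonormalBasis ℝ V a)) := by
  intro u
  simp only [comp_pinv_inner hD]
  conv_rhs => rw [← pinv_comp_self hD u, ← (stdOrthonormalBasis ℝ V).sum_repr' (D u)]
  simp

lemma continuousAt_pinv {D : E →L[ℝ] V} (hD : Function.Injective D) :
    ContinuousAt (pinv : (E →L[ℝ] V) → _) D := by
  have h1 : Continuous (fun D : E →L[ℝ] V => ContinuousLinearMap.adjoint D) :=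
    ContinuousLinearMap.adjoint.continuous
  have h2 : Continuous (fun D : E →L[ℝ] V => (ContinuousLinearMap.adjoint D).comp D) :=
    h1.clm_comp continuous_id
  obtain ⟨w, hw⟩ := isUnit_adjoint_comp_self hD
  have h3 : ContinuousAt (fun D : E →L[ℝ] V =>
      Ring.inverse ((ContinuousLinearMap.adjoint D).comp D)) D :=
    ContinuousAt.comp (g := Ring.inverse)
      (f := fun D : E →L[ℝ] V => (ContinuousLinearMap.adjoint D).comp D)
      (by rw [← hw]; exact NormedRing.inverse_continuousAt w) h2.continuousAt
  exact h3.clm_comp h1.continuousAt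

/-- The component of `v` orthogonal to the range of `D` and to the unit vector `q`. -/
lemma normalProj_eq_sub {D : E →L[ℝ] V} (hD : Function.Injective D) {q : V}
    (hq : ‖q‖ = 1) (hDq : ∀ u, inner ℝ (D u) q = (0 : ℝ)) (v : V) :
    normalProj D q v = v - D (pinv D v) - (inner ℝ q v : ℝ) • q := by
  refine normalProj_eq (w := pinv D v) (t := inner ℝ q v) (fun u => ?_) ?_ (by abel)
  · rw [inner_sub_right, inner_sub_right, inner_smul_right, hDq, real_inner_comm (D (pinv D v)),
      comp_pinv_inner hD, real_inner_comm]
    simp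
  · rw [inner_sub_right, inner_sub_right, inner_smul_right, real_inner_comm (D _) q, hDq,
      real_inner_self_eq_norm_sq, hq]
    simp

end Pseudoinverse

section SphereMaps

variable {E : Type*} [NormedAddCommGroup E] [NormedSpace ℝ E]
  {V : Type*} [NormedAddCommGroup V] [InnerProductSpace ℝ V]

lemma inner_fderiv_self_of_sphere {g : E → V} {y : E} (hg : DifferentiableAt ℝ g y)
    (hs : ∀ᶠ z in 𝓝 y, ‖g z‖ = 1) (u : E) : inner ℝ (fderiv ℝ g y u) (g y) = (0 : ℝ) := by
  have h1 : (fun z => (inner ℝ (g z) (g z) : ℝ)) =ᶠ[𝓝 y] fun _ => 1 := by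
    filter_upwards [hs] with z hz
    rw [real_inner_self_eq_norm_sq, hz]; norm_num
  have h2 := fderiv_inner_apply ℝ hg hg u
  rw [h1.fderiv_eq, real_inner_comm] at h2
  simp at h2
  linarith

lemma inner_fderiv_fderiv_of_sphere {g : E → V} {y : E} (hg : ContDiffAt ℝ 2 g y)
    (hs : ∀ᶠ z in 𝓝 y, ‖g z‖ = 1) (u v : E) :
    inner ℝ (g y) (fderiv ℝ (fderiv ℝ g) y u v) =
      -(inner ℝ (fderiv ℝ g y u) (fderiv ℝ g y v) : ℝ) := by
  have hd : ∀ᶠ z in 𝓝 y, DifferentiableAt ℝ g z :=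
    (hg.eventually (by simp)).mono fun z hz => hz.differentiableAt (by simp)
  have hd2 : DifferentiableAt ℝ (fderiv ℝ g) y :=
    (hg.fderiv_right (m := 1) (by norm_num)).differentiableAt (by simp)
  have h1 : (fun z => (inner ℝ (fderiv ℝ g z v) (g z) : ℝ)) =ᶠ[𝓝 y] fun _ => 0 := by
    filter_upwards [hs.eventually_nhds, hd] with z hz hz'
    exact inner_fderiv_self_of_sphere hz' hz v
  have h2 := fderiv_inner_apply ℝ (hd2.clm_apply (differentiableAt_const v)) hd.self_of_nhds u
  rw [h1.fderiv_eq, fderiv_clm_apply hd2 (differentiableAt_const v)] at h2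
  simp at h2
  rw [real_inner_comm, real_inner_comm (fderiv ℝ g y v)]
  linarith

variable [FiniteDimensional ℝ V]

/-- The second fundamental form at `y` of a map `g` into the unit sphere. -/
def sffAt (g : E → V) (y : E) : E →L[ℝ] E →L[ℝ] V :=
  (ContinuousLinearMap.compL ℝ E V V (normalProj (fderiv ℝ g y) (g y))).comp
    (fderiv ℝ (fderiv ℝ g) y)

lemma sffAt_apply (g : E → V) (y u v : E) :
    sffAt g y u v = normalProj (fderiv ℝ g y) (g y) (fderiv ℝ (fderiv ℝ g) y u v) := rfl

lemma inner_sffAt (g : E → V) (y u v : E) : inner ℝ (g y) (sffAt g y u v) = (0 : ℝ) :=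
  (inner_normalProj _ _ _).2

lemma inner_fderiv_sffAt (g : E → V) (y u v w : E) :
    inner ℝ (fderiv ℝ g y w) (sffAt g y u v) = (0 : ℝ) :=
  (inner_normalProj _ _ _).1 w

lemma exists_fderiv_fderiv_eq {g : E → V} {y : E} (hg : ContDiffAt ℝ 2 g y)
    (hs : ∀ᶠ z in 𝓝 y, ‖g z‖ = 1) (u v : E) :
    ∃ w, fderiv ℝ (fderiv ℝ g) y u v = fderiv ℝ g y w + sffAt g y u v -
      (inner ℝ (fderiv ℝ g y u) (fderiv ℝ g y v) : ℝ) • g y := by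
  obtain ⟨w, hw⟩ := exists_normal_decomposition (D := fderiv ℝ g y) hs.self_of_nhds
    (inner_fderiv_self_of_sphere (hg.differentiableAt (by simp)) hs)
    (fderiv ℝ (fderiv ℝ g) y u v)
  rw [inner_fderiv_fderiv_of_sphere hg hs, neg_smul, ← sub_eq_add_neg] at hw
  exact ⟨w, hw⟩

end SphereMaps

section Product

variable {ι : Type*} [Fintype ι] {E V : ι → Type*}
  [∀ j, NormedAddCommGroup (E j)] [∀ j, NormedSpace ℝ (E j)]
  [∀ j, NormedAddCommGroup (V j)] [∀ j, InnerProductSpace ℝ (V j)]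

/-- The orthogonal product of maps between vector spaces, with coefficients. -/
def prodRep (c : ι → ℝ) (g : ∀ j, E j → V j) (y : ∀ j, E j) : PiLp 2 V :=
  WithLp.toLp 2 fun j => c j • g j (y j)

/-- The orthogonal product of continuous linear maps, with coefficients. -/
def prodRepL (c : ι → ℝ) (D : ∀ j, E j →L[ℝ] V j) : (∀ j, E j) →L[ℝ] PiLp 2 V :=
  ((PiLp.continuousLinearEquiv 2 ℝ V).symm : (∀ j, V j) →L[ℝ] PiLp 2 V).comp
    (ContinuousLinearMap.pi fun j => c j • (D j).comp (ContinuousLinearMap.proj j))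

lemma prodRepL_apply (c : ι → ℝ) (D : ∀ j, E j →L[ℝ] V j) (u : ∀ j, E j) :
    prodRepL c D u = WithLp.toLp 2 fun j => c j • D j (u j) := rfl

lemma prodRepL_apply_apply (c : ι → ℝ) (D : ∀ j, E j →L[ℝ] V j) (u : ∀ j, E j) (j : ι) :
    prodRepL c D u j = c j • D j (u j) := rfl

lemma hasFDerivAt_prodRep {c : ι → ℝ} {g : ∀ j, E j → V j} {y : ∀ j, E j}
    {D : ∀ j, E j →L[ℝ] V j} (hg : ∀ j, HasFDerivAt (g j) (D j) (y j)) :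
    HasFDerivAt (prodRep c g) (prodRepL c D) y := by
  have h : HasFDerivAt (fun y : ∀ j, E j => fun j => c j • g j (y j))
      (ContinuousLinearMap.pi fun j => c j • (D j).comp (ContinuousLinearMap.proj j)) y := by
    rw [hasFDerivAt_pi]
    intro j
    exact ((hg j).comp y (hasFDerivAt_apply j y)).const_smul (c j)
  exact (PiLp.continuousLinearEquiv 2 ℝ V).symm.hasFDerivAt.comp y h

lemma fderiv_prodRep {c : ι → ℝ} {g : ∀ j, E j → V j} {y : ∀ j, E j}
    (hg : ∀ j, DifferentiableAt ℝ (g j) (y j)) :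
    fderiv ℝ (prodRep c g) y = prodRepL c fun j => fderiv ℝ (g j) (y j) :=
  (hasFDerivAt_prodRep fun j => (hg j).hasFDerivAt).fderiv

lemma contDiffAt_prodRep {m : WithTop ℕ∞} {c : ι → ℝ} {g : ∀ j, E j → V j} {y : ∀ j, E j}
    (hg : ∀ j, ContDiffAt ℝ m (g j) (y j)) : ContDiffAt ℝ m (prodRep c g) y := by
  have h : ContDiffAt ℝ m (fun y : ∀ j, E j => fun j => c j • g j (y j)) y := by
    rw [contDiffAt_pi]
    intro j
    exact contDiffAt_const.smul ((hg j).comp y (contDiffAt_pi.1 contDiffAt_id j))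
  exact (PiLp.continuousLinearEquiv 2 ℝ V).symm.contDiff.contDiffAt.comp y h

lemma fderiv_fderiv_prodRep {c : ι → ℝ} {g : ∀ j, E j → V j} {y : ∀ j, E j}
    (hg : ∀ j, ContDiffAt ℝ 2 (g j) (y j)) (u v : ∀ j, E j) :
    fderiv ℝ (fderiv ℝ (prodRep c g)) y u v =
      WithLp.toLp 2 fun j => c j • fderiv ℝ (fderiv ℝ (g j)) (y j) (u j) (v j) := by
  have hd2 : DifferentiableAt ℝ (fderiv ℝ (prodRep c g)) y :=
    ((contDiffAt_prodRep hg).fderiv_right (m := 1) (by norm_num)).differentiableAt (by simp)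
  have hd2j (j) : DifferentiableAt ℝ (fderiv ℝ (g j)) (y j) :=
    ((hg j).fderiv_right (m := 1) (by norm_num)).differentiableAt (by simp)
  have hd : ∀ᶠ z in 𝓝 y, ∀ j, DifferentiableAt ℝ (g j) (z j) := by
    rw [Filter.eventually_all]
    intro j
    have := ((hg j).eventually (by simp)).mono fun z hz => hz.differentiableAt (by simp)
    exact (continuous_apply j).continuousAt.eventually this
  have h1 : (fun z => fderiv ℝ (prodRep c g) z v) =ᶠ[𝓝 y]
      prodRep c fun j z => fderiv ℝ (g j) z (v j) := by
    filter_upwards [hd] with z hz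
    rw [fderiv_prodRep hz]
    rfl
  have h2 : fderiv ℝ (fun z => fderiv ℝ (prodRep c g) z v) y u =
      fderiv ℝ (fderiv ℝ (prodRep c g)) y u v := by
    rw [fderiv_clm_apply hd2 (differentiableAt_const v)]
    simp
  rw [← h2, h1.fderiv_eq,
    fderiv_prodRep fun j => (hd2j j).clm_apply (differentiableAt_const (v j)), prodRepL_apply]
  congr 1
  ext j
  rw [fderiv_clm_apply (hd2j j) (differentiableAt_const (v j))]
  simp

variable [∀ j, FiniteDimensional ℝ (V j)]

lemma sffAt_prodRep {c : ι → ℝ} (hc : ∑ j, c j ^ 2 = 1) {g : ∀ j, E j → V j} {y : ∀ j, E j}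
    (hg : ∀ j, ContDiffAt ℝ 2 (g j) (y j)) (hs : ∀ j, ∀ᶠ z in 𝓝 (y j), ‖g j z‖ = 1)
    (u v : ∀ j, E j) :
    sffAt (prodRep c g) y u v = WithLp.toLp 2 fun j => c j • (sffAt (g j) (y j) (u j) (v j) +
      (∑ l, c l ^ 2 * inner ℝ (fderiv ℝ (g l) (y l) (u l)) (fderiv ℝ (g l) (y l) (v l)) -
        (inner ℝ (fderiv ℝ (g j) (y j) (u j)) (fderiv ℝ (g j) (y j) (v j)) : ℝ)) •
          g j (y j)) := by
  have hd (j) : DifferentiableAt ℝ (g j) (y j) := (hg j).differentiableAt (by simp)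
  choose w hw using fun j => exists_fderiv_fderiv_eq (hg j) (hs j) (u j) (v j)
  rw [sffAt_apply, fderiv_prodRep hd, fderiv_fderiv_prodRep hg]
  set G : ℝ := ∑ l, c l ^ 2 * inner ℝ (fderiv ℝ (g l) (y l) (u l)) (fderiv ℝ (g l) (y l) (v l))
  refine normalProj_eq (w := w) (t := -G) (fun x => ?_) ?_ ?_
  · rw [PiLp.inner_apply]
    refine Finset.sum_eq_zero fun j _ => ?_
    rw [prodRepL_apply_apply]
    simp only [inner_smul_left, inner_smul_right, inner_add_right, inner_fderiv_sffAt,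
      inner_fderiv_self_of_sphere (hd j) (hs j)]
    simp
  · have hn (j) : (inner ℝ (g j (y j)) (g j (y j)) : ℝ) = 1 := by
      rw [real_inner_self_eq_norm_sq, (hs j).self_of_nhds]; norm_num
    rw [PiLp.inner_apply]
    simp only [prodRep, inner_smul_left, inner_smul_right, inner_add_right, inner_sffAt, hn]
    simp only [conj_trivial, mul_one]
    have : ∀ j, c j * (c j * 0 + (G - inner ℝ (fderiv ℝ (g j) (y j) (u j))
        (fderiv ℝ (g j) (y j) (v j))) * c j) = c j ^ 2 * G - c j ^ 2 *
        inner ℝ (fderiv ℝ (g j) (y j) (u j)) (fderiv ℝ (g j) (y j) (v j)) := fun j => by ring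
    simp only [this, Finset.sum_sub_distrib, ← Finset.sum_mul, hc]
    simp [G]
  · ext j
    simp only [PiLp.add_apply, PiLp.smul_apply, prodRepL_apply_apply, prodRep, hw]
    module

lemma norm_sq_sffAt_prodRep {c : ι → ℝ} (hc : ∑ j, c j ^ 2 = 1) {g : ∀ j, E j → V j}
    {y : ∀ j, E j} (hg : ∀ j, ContDiffAt ℝ 2 (g j) (y j))
    (hs : ∀ j, ∀ᶠ z in 𝓝 (y j), ‖g j z‖ = 1) (u v : ∀ j, E j) :
    ‖sffAt (prodRep c g) y u v‖ ^ 2 =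
      ∑ j, c j ^ 2 * ‖sffAt (g j) (y j) (u j) (v j)‖ ^ 2 +
      ∑ j, c j ^ 2 * inner ℝ (fderiv ℝ (g j) (y j) (u j)) (fderiv ℝ (g j) (y j) (v j)) ^ 2 -
      (∑ j, c j ^ 2 *
        (inner ℝ (fderiv ℝ (g j) (y j) (u j)) (fderiv ℝ (g j) (y j) (v j)) : ℝ)) ^ 2 := by
  rw [sffAt_prodRep hc hg hs, PiLp.norm_sq_eq_of_L2]
  set G : ℝ := ∑ l, c l ^ 2 * inner ℝ (fderiv ℝ (g l) (y l) (u l)) (fderiv ℝ (g l) (y l) (v l))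
    with hG
  have h (j) (t : ℝ) : ‖c j • (sffAt (g j) (y j) (u j) (v j) + t • g j (y j))‖ ^ 2 =
      c j ^ 2 * ‖sffAt (g j) (y j) (u j) (v j)‖ ^ 2 + c j ^ 2 * t ^ 2 := by
    rw [norm_smul, mul_pow, @norm_add_sq_real, inner_smul_right, real_inner_comm, inner_sffAt,
      norm_smul, (hs j).self_of_nhds]
    simp
    ring
  simp only [h, Finset.sum_add_distrib]
  have h' (j) (t : ℝ) : c j ^ 2 * (G - t) ^ 2 = G ^ 2 * c j ^ 2 - 2 * G * (c j ^ 2 * t) +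
    c j ^ 2 * t ^ 2 := by ring
  simp only [h', Finset.sum_add_distrib, Finset.sum_sub_distrib, ← Finset.mul_sum, hc, ← hG]
  ring

variable {κ : ι → Type*} [∀ j, Fintype (κ j)] [DecidableEq ι]

/-- The frame of a product made of frames of the factors. -/
def prodFrame (c : ι → ℝ) (e : ∀ j, κ j → E j) (p : Σ j, κ j) : ∀ j, E j :=
  Pi.single p.1 ((c p.1)⁻¹ • e p.1 p.2)

lemma inner_prodRepL_single (c : ι → ℝ) (D : ∀ j, E j →L[ℝ] V j) (j : ι) (a : E j)
    (u : ∀ j, E j) : inner ℝ (prodRepL c D (Pi.single j a)) (prodRepL c D u) =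
      c j ^ 2 * (inner ℝ (D j a) (D j (u j)) : ℝ) := by
  rw [PiLp.inner_apply, Finset.sum_eq_single j]
  · simp only [prodRepL_apply_apply, Pi.single_eq_same, inner_smul_left, inner_smul_right]
    simp only [conj_trivial]; ring
  · intro l _ hl
    simp [prodRepL_apply_apply, Pi.single_eq_of_ne hl]
  · simp

lemma isReproducing_prodFrame {c : ι → ℝ} (hc : ∀ j, c j ≠ 0) {D : ∀ j, E j →L[ℝ] V j}
    {e : ∀ j, κ j → E j} (he : ∀ j, IsReproducing (D j) (e j)) :
    IsReproducing (prodRepL c D) (prodFrame c e) := by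
  intro u
  rw [Fintype.sum_sigma]
  conv_rhs => rw [← Finset.univ_sum_single u]
  refine Finset.sum_congr rfl fun j _ => ?_
  conv_rhs => rw [← he j (u j)]
  rw [← LinearMap.single_apply (R := ℝ), map_sum]
  refine Finset.sum_congr rfl fun i _ => ?_
  simp only [prodFrame, inner_prodRepL_single, map_smul, inner_smul_left, ← Pi.single_smul,
    LinearMap.single_apply, smul_smul]
  congr 2
  simp only [conj_trivial]
  field_simp [hc j]

lemma norm_sq_sffAt_prodRep_single {c : ι → ℝ} (hc : ∑ j, c j ^ 2 = 1) {g : ∀ j, E j → V j}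
    {y : ∀ j, E j} (hg : ∀ j, ContDiffAt ℝ 2 (g j) (y j))
    (hs : ∀ j, ∀ᶠ z in 𝓝 (y j), ‖g j z‖ = 1) (j : ι) (a b : E j) :
    ‖sffAt (prodRep c g) y (Pi.single j a) (Pi.single j b)‖ ^ 2 =
      c j ^ 2 * ‖sffAt (g j) (y j) a b‖ ^ 2 +
      c j ^ 2 * inner ℝ (fderiv ℝ (g j) (y j) a) (fderiv ℝ (g j) (y j) b) ^ 2 -
      (c j ^ 2 * (inner ℝ (fderiv ℝ (g j) (y j) a) (fderiv ℝ (g j) (y j) b) : ℝ)) ^ 2 := by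
  rw [norm_sq_sffAt_prodRep hc hg hs, Finset.sum_eq_single j, Finset.sum_eq_single j,
    Finset.sum_eq_single j] <;>
  first
    | (simp only [Pi.single_eq_same]; done)
    | (intro l _ hl; simp [Pi.single_eq_of_ne hl])
    | simp

lemma sffAt_prodRep_single_ne {c : ι → ℝ} (hc : ∑ j, c j ^ 2 = 1) {g : ∀ j, E j → V j}
    {y : ∀ j, E j} (hg : ∀ j, ContDiffAt ℝ 2 (g j) (y j))
    (hs : ∀ j, ∀ᶠ z in 𝓝 (y j), ‖g j z‖ = 1) {j l : ι} (hjl : j ≠ l) (a : E j) (b : E l) :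
    sffAt (prodRep c g) y (Pi.single j a) (Pi.single l b) = 0 := by
  have h (m : ι) : (Pi.single j a : ∀ j, E j) m = 0 ∨ (Pi.single l b : ∀ j, E j) m = 0 := by
    rcases eq_or_ne m j with rfl | hm
    · exact Or.inr (Pi.single_eq_of_ne hjl b)
    · exact Or.inl (Pi.single_eq_of_ne hm a)
  rw [sffAt_prodRep hc hg hs]
  have h1 (m : ι) : (inner ℝ (fderiv ℝ (g m) (y m) ((Pi.single j a : ∀ j, E j) m))
      (fderiv ℝ (g m) (y m) ((Pi.single l b : ∀ j, E j) m)) : ℝ) = 0 := by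
    rcases h m with h | h <;> simp [h]
  have h2 (m : ι) : sffAt (g m) (y m) ((Pi.single j a : ∀ j, E j) m)
      ((Pi.single l b : ∀ j, E j) m) = 0 := by
    rcases h m with h | h <;> simp [h]
  simp only [h1, h2]
  ext m
  simp

lemma sum_norm_sq_sffAt_prodFrame {c : ι → ℝ} (hc0 : ∀ j, c j ≠ 0) (hc : ∑ j, c j ^ 2 = 1)
    {g : ∀ j, E j → V j} {y : ∀ j, E j} (hg : ∀ j, ContDiffAt ℝ 2 (g j) (y j))
    (hs : ∀ j, ∀ᶠ z in 𝓝 (y j), ‖g j z‖ = 1) (e : ∀ j, κ j → E j) :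
    ∑ p, ∑ q, ‖sffAt (prodRep c g) y (prodFrame c e p) (prodFrame c e q)‖ ^ 2 =
      ∑ j, ((c j ^ 2)⁻¹ * ∑ a, ∑ b, ‖sffAt (g j) (y j) (e j a) (e j b)‖ ^ 2 +
        ((c j ^ 2)⁻¹ - 1) * ∑ a, ∑ b, (inner ℝ (fderiv ℝ (g j) (y j) (e j a))
          (fderiv ℝ (g j) (y j) (e j b)) : ℝ) ^ 2) := by
  rw [Fintype.sum_sigma]
  refine Finset.sum_congr rfl fun j _ => ?_
  rw [Finset.mul_sum, Finset.mul_sum, ← Finset.sum_add_distrib]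
  refine Finset.sum_congr rfl fun a _ => ?_
  rw [Fintype.sum_sigma, Finset.sum_eq_single j]
  · rw [Finset.mul_sum, Finset.mul_sum, ← Finset.sum_add_distrib]
    refine Finset.sum_congr rfl fun b _ => ?_
    rw [prodFrame, prodFrame, norm_sq_sffAt_prodRep_single hc hg hs]
    simp only [map_smul, smul_apply, inner_smul_left, inner_smul_right,
      norm_smul, norm_inv, conj_trivial, mul_pow, inv_pow, Real.norm_eq_abs, sq_abs]
    have := hc0 j
    field_simp
    ring
  · intro l _ hl
    refine Finset.sum_eq_zero fun b _ => ?_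
    rw [prodFrame, prodFrame, sffAt_prodRep_single_ne hc hg hs hl.symm]
    simp
  · simp

lemma sum_sffAt_prodFrame_apply {c : ι → ℝ} (hc0 : ∀ j, c j ≠ 0) (hc : ∑ j, c j ^ 2 = 1)
    {g : ∀ j, E j → V j} {y : ∀ j, E j} (hg : ∀ j, ContDiffAt ℝ 2 (g j) (y j))
    (hs : ∀ j, ∀ᶠ z in 𝓝 (y j), ‖g j z‖ = 1) (e : ∀ j, κ j → E j) (j : ι) :
    (∑ p, sffAt (prodRep c g) y (prodFrame c e p) (prodFrame c e p)) j =
      (c j)⁻¹ • ∑ a, sffAt (g j) (y j) (e j a) (e j a) +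
      (c j * (∑ l, ∑ a, ‖fderiv ℝ (g l) (y l) (e l a)‖ ^ 2) -
        (c j)⁻¹ * ∑ a, ‖fderiv ℝ (g j) (y j) (e j a)‖ ^ 2) • g j (y j) := by
  have key (l : ι) (a : κ l) :
      sffAt (prodRep c g) y (prodFrame c e ⟨l, a⟩) (prodFrame c e ⟨l, a⟩) j =
      (if h : l = j then (c j)⁻¹ • sffAt (g j) (y j) (e j (h ▸ a)) (e j (h ▸ a)) -
        ((c j)⁻¹ * ‖fderiv ℝ (g j) (y j) (e j (h ▸ a))‖ ^ 2) • g j (y j) else 0) +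
      (c j * ‖fderiv ℝ (g l) (y l) (e l a)‖ ^ 2) • g j (y j) := by
    have hsum : ∑ m, c m ^ 2 * (inner ℝ (fderiv ℝ (g m) (y m) (prodFrame c e ⟨l, a⟩ m))
        (fderiv ℝ (g m) (y m) (prodFrame c e ⟨l, a⟩ m)) : ℝ) =
        ‖fderiv ℝ (g l) (y l) (e l a)‖ ^ 2 := by
      rw [Finset.sum_eq_single l]
      · simp only [prodFrame, Pi.single_eq_same, map_smul, real_inner_self_eq_norm_sq, norm_smul,
          norm_inv, mul_pow, inv_pow, Real.norm_eq_abs, sq_abs]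
        have := hc0 l
        field_simp
      · intro m _ hm
        simp [prodFrame, Pi.single_eq_of_ne hm]
      · simp
    rw [sffAt_prodRep hc hg hs, hsum]
    dsimp only
    split_ifs with h
    · subst h
      simp only [prodFrame, Pi.single_eq_same, map_smul, smul_apply,
        real_inner_self_eq_norm_sq, norm_smul, norm_inv, mul_pow, inv_pow, Real.norm_eq_abs,
        sq_abs, smul_add, sub_smul, smul_sub, smul_smul]
      have := hc0 l
      have h1 : c l * ((c l)⁻¹ * (c l)⁻¹) = (c l)⁻¹ := by field_simp
      have h2 (t : ℝ) : c l * ((c l ^ 2)⁻¹ * t) = (c l)⁻¹ * t := by field_simp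
      rw [h1, h2]
      abel
    · simp only [prodFrame, Pi.single_eq_of_ne (Ne.symm h)]
      simp [smul_smul]
  rw [WithLp.ofLp_sum, Finset.sum_apply, Fintype.sum_sigma]
  simp only [key, Finset.sum_add_distrib, ← Finset.sum_smul]
  rw [Finset.sum_eq_single j (fun l _ hl => by simp [hl]) (by simp)]
  simp only [dif_pos, Finset.sum_sub_distrib, ← Finset.sum_smul, ← Finset.smul_sum,
    ← Finset.mul_sum]
  module

end Product

lemma two_le_infty : (2 : WithTop ℕ∞) ≤ (∞ : WithTop ℕ∞) :=
  WithTop.coe_le_coe.2 (le_top : (2 : ℕ∞) ≤ ⊤)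

section ChangeOfVariables

variable {E : Type*} [NormedAddCommGroup E] [NormedSpace ℝ E]
  {V : Type*} [NormedAddCommGroup V] [InnerProductSpace ℝ V] [FiniteDimensional ℝ V]

lemma normalProj_comp (D : E →L[ℝ] V) {T : E →L[ℝ] E} (hT : Function.Surjective T) (q : V) :
    normalProj (D.comp T) q = normalProj D q := by
  have : LinearMap.range ((D.comp T : E →L[ℝ] V) : E →ₗ[ℝ] V) =
      LinearMap.range (D : E →ₗ[ℝ] V) := by
    exact LinearMap.range_comp_of_range_eq_top _ (LinearMap.range_eq_top.2 hT)
  unfold normalProj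
  congr 3

lemma normalProj_apply_range (D : E →L[ℝ] V) (q : V) (w : E) : normalProj D q (D w) = 0 :=
  normalProj_eq (w := w) (t := 0) (by simp) (by simp) (by simp)

lemma sffAt_congr {g g' : E → V} {y : E} (h : g =ᶠ[𝓝 y] g') : sffAt g y = sffAt g' y := by
  ext u v
  rw [sffAt_apply, sffAt_apply, h.fderiv.fderiv_eq, h.fderiv_eq, h.eq_of_nhds]

lemma sffAt_comp {g : E → V} {τ : E → E} {y : E} (hg : ContDiffAt ℝ 2 g (τ y))
    (hτ : ContDiffAt ℝ 2 τ y) (hT : Function.Surjective (fderiv ℝ τ y)) (u v : E) :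
    sffAt (g ∘ τ) y u v = sffAt g (τ y) (fderiv ℝ τ y u) (fderiv ℝ τ y v) := by
  have hd : ∀ᶠ z in 𝓝 y, DifferentiableAt ℝ g (τ z) :=
    hτ.continuousAt.eventually
      ((hg.eventually (by simp)).mono fun z hz => hz.differentiableAt (by simp))
  have hdτ : ∀ᶠ z in 𝓝 y, DifferentiableAt ℝ τ z :=
    (hτ.eventually (by simp)).mono fun z hz => hz.differentiableAt (by simp)
  have hg2 : DifferentiableAt ℝ (fderiv ℝ g) (τ y) :=
    (hg.fderiv_right (m := 1) (by norm_num)).differentiableAt (by simp)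
  have hτ2 : DifferentiableAt ℝ (fderiv ℝ τ) y :=
    (hτ.fderiv_right (m := 1) (by norm_num)).differentiableAt (by simp)
  have hgτ2 : DifferentiableAt ℝ (fderiv ℝ (g ∘ τ)) y :=
    ((hg.comp y hτ).fderiv_right (m := 1) (by norm_num)).differentiableAt (by simp)
  have h1 : (fun z => fderiv ℝ (g ∘ τ) z v) =ᶠ[𝓝 y]
      fun z => fderiv ℝ g (τ z) (fderiv ℝ τ z v) := by
    filter_upwards [hd, hdτ] with z hz hz'
    rw [fderiv_comp z hz hz']
    rfl
  have h2 : fderiv ℝ (fun z => fderiv ℝ (g ∘ τ) z v) y u = fderiv ℝ (fderiv ℝ (g ∘ τ)) y u v := by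
    rw [fderiv_clm_apply hgτ2 (differentiableAt_const v)]
    simp
  have h3 : DifferentiableAt ℝ (fun z => fderiv ℝ g (τ z)) y := hg2.comp y hdτ.self_of_nhds
  have h4 : fderiv ℝ (fun z => fderiv ℝ g (τ z)) y =
      (fderiv ℝ (fderiv ℝ g) (τ y)).comp (fderiv ℝ τ y) :=
    fderiv_comp y hg2 hdτ.self_of_nhds
  have h5 : fderiv ℝ (fderiv ℝ (g ∘ τ)) y u v =
      fderiv ℝ g (τ y) (fderiv ℝ (fderiv ℝ τ) y u v) +
        fderiv ℝ (fderiv ℝ g) (τ y) (fderiv ℝ τ y u) (fderiv ℝ τ y v) := by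
    rw [← h2, h1.fderiv_eq, fderiv_clm_apply h3 (hτ2.clm_apply (differentiableAt_const v)), h4,
      fderiv_clm_apply hτ2 (differentiableAt_const v)]
    simp
  rw [sffAt_apply, h5, fderiv_comp y hd.self_of_nhds hdτ.self_of_nhds, normalProj_comp _ hT,
    map_add, Function.comp_apply, normalProj_apply_range, zero_add]
  rfl

end ChangeOfVariables

section Charts

variable {E : Type*} [NormedAddCommGroup E] [NormedSpace ℝ E] [FiniteDimensional ℝ E]
  {H : Type*} [TopologicalSpace H] {I : ModelWithCorners ℝ E H}
  {M : Type*} [TopologicalSpace M] [ChartedSpace H M]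
  {V : Type*} [NormedAddCommGroup V] [InnerProductSpace ℝ V] [FiniteDimensional ℝ V]

lemma localRep_extChartAt {f : M → V} {x x' : M} (h : x' ∈ (extChartAt I x).source) :
    localRep I f x (extChartAt I x x') = f x' := by
  simp only [localRep, Function.comp_apply, (extChartAt I x).left_inv h]

lemma secondFundamentalForm_eq_sffAt (f : M → V) (x : M) (u v : E) :
    secondFundamentalForm I f x u v = sffAt (localRep I f x) (extChartAt I x x) u v := by
  rw [sffAt_apply, localRep_extChartAt (mem_extChartAt_source x)]
  rfl

lemma isReproducing_orthonormalFrame {f : M → V} {x : M} (h : Function.Injective (dAt I f x)) :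
    IsReproducing (dAt I f x) (orthonormalFrame I f x) := by
  intro u
  apply h
  have he (i) : dAt I f x (orthonormalFrame I f x i) =
      (stdOrthonormalBasis ℝ (tangentPlane I f x) i : V) := by
    have := Function.surjInv_eq (LinearMap.surjective_rangeRestrict (dAt I f x : E →ₗ[ℝ] V))
      (stdOrthonormalBasis ℝ (tangentPlane I f x) i)
    exact congrArg Subtype.val this
  have := congrArg Subtype.val ((stdOrthonormalBasis ℝ (tangentPlane I f x)).sum_repr'
    ⟨dAt I f x u, LinearMap.mem_range_self _ u⟩)
  rw [map_sum]
  simp only [map_smul, he]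
  simpa using this

lemma dAt_orthonormalFrame (f : M → V) (x : M) (i) :
    dAt I f x (orthonormalFrame I f x i) = (stdOrthonormalBasis ℝ (tangentPlane I f x) i : V) :=
  congrArg Subtype.val
    (Function.surjInv_eq (LinearMap.surjective_rangeRestrict (dAt I f x : E →ₗ[ℝ] V)) _)

lemma finrank_tangentPlane {f : M → V} {x : M} (h : Function.Injective (dAt I f x)) :
    Module.finrank ℝ (tangentPlane I f x) = Module.finrank ℝ E :=
  LinearMap.finrank_range_of_inj h

variable [I.Boundaryless] [IsManifold I ∞ M]

lemma contDiffAt_localRep {f : M → V} (hf : ContMDiff I 𝓘(ℝ, V) ∞ f) {x : M} {y : E}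
    (hy : y ∈ (extChartAt I x).target) : ContDiffAt ℝ ∞ (localRep I f x) y := by
  have h1 : ContMDiffOn 𝓘(ℝ, E) 𝓘(ℝ, V) ∞ (localRep I f x) (extChartAt I x).target :=
    hf.comp_contMDiffOn (contMDiffOn_extChartAt_symm x)
  exact (contMDiffOn_iff_contDiffOn.1 h1).contDiffAt ((isOpen_extChartAt_target x).mem_nhds hy)

lemma mfderiv_eq_dAt {f : M → V} (hf : ContMDiff I 𝓘(ℝ, V) ∞ f) (x : M) :
    mfderiv I 𝓘(ℝ, V) f x = dAt I f x := by
  have h : MDifferentiableAt I 𝓘(ℝ, V) f x := (hf x).mdifferentiableAt (by simp)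
  simp only [mfderiv, h, I.range_eq_univ, fderivWithin_univ]
  rfl

/-- The coordinate change from the preferred chart at `x` to the preferred chart at `x'`. -/
def transition (I : ModelWithCorners ℝ E H) (x x' : M) : E → E :=
  extChartAt I x' ∘ (extChartAt I x).symm

lemma eventually_mem_overlap {x x' : M} {y : E} (hy : y ∈ (extChartAt I x).target)
    (hy' : (extChartAt I x).symm y ∈ (extChartAt I x').source) :
    ∀ᶠ z in 𝓝 y, z ∈ (extChartAt I x).target ∧
      (extChartAt I x).symm z ∈ (extChartAt I x').source := by
  have h1 := (isOpen_extChartAt_target (I := I) x).mem_nhds hy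
  refine Filter.Eventually.and h1 ?_
  exact ((continuousOn_extChartAt_symm x).continuousAt h1).eventually
    ((isOpen_extChartAt_source x').mem_nhds hy')

lemma contDiffAt_transition {x x' : M} {y : E} (hy : y ∈ (extChartAt I x).target)
    (hy' : (extChartAt I x).symm y ∈ (extChartAt I x').source) :
    ContDiffAt ℝ ∞ (transition I x x') y := by
  have h1 : ContMDiffAt 𝓘(ℝ, E) I ∞ (extChartAt I x).symm y :=
    (contMDiffOn_extChartAt_symm x).contMDiffAt ((isOpen_extChartAt_target x).mem_nhds hy)
  have h2 : ContMDiffAt I 𝓘(ℝ, E) ∞ (extChartAt I x') ((extChartAt I x).symm y) :=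
    contMDiffAt_extChartAt' (by rwa [extChartAt_source] at hy')
  exact contMDiffAt_iff_contDiffAt.1 (h2.comp y h1)

lemma localRep_eventuallyEq {x x' : M} {y : E} (f : M → V) (hy : y ∈ (extChartAt I x).target)
    (hy' : (extChartAt I x).symm y ∈ (extChartAt I x').source) :
    localRep I f x =ᶠ[𝓝 y] localRep I f x' ∘ transition I x x' := by
  filter_upwards [eventually_mem_overlap hy hy'] with z hz
  simp only [localRep, transition, Function.comp_apply, (extChartAt I x').left_inv hz.2]

lemma bijective_fderiv_transition {x x' : M} {y : E} (hy : y ∈ (extChartAt I x).target)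
    (hy' : (extChartAt I x).symm y ∈ (extChartAt I x').source) :
    Function.Bijective (fderiv ℝ (transition I x x') y) := by
  have hinv : transition I x' x ∘ transition I x x' =ᶠ[𝓝 y] id := by
    filter_upwards [eventually_mem_overlap hy hy'] with z hz
    simp only [transition, Function.comp_apply, (extChartAt I x').left_inv hz.2,
      (extChartAt I x).right_inv hz.1, id]
  have ht : transition I x x' y ∈ (extChartAt I x').target := (extChartAt I x').map_source hy'
  have ht' : (extChartAt I x').symm (transition I x x' y) ∈ (extChartAt I x).source := by
    simp only [transition, Function.comp_apply, (extChartAt I x').left_inv hy']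
    exact (extChartAt I x).map_target hy
  have h1 : (fderiv ℝ (transition I x' x) (transition I x x' y)).comp
      (fderiv ℝ (transition I x x') y) = ContinuousLinearMap.id ℝ E := by
    rw [← fderiv_comp y ((contDiffAt_transition ht ht').differentiableAt (by simp))
      ((contDiffAt_transition hy hy').differentiableAt (by simp)), hinv.fderiv_eq, fderiv_id]
  have hinj : Function.Injective (fderiv ℝ (transition I x x') y) := by
    intro a b hab
    have ha := DFunLike.congr_fun h1 a
    have hb := DFunLike.congr_fun h1 b
    simp only [ContinuousLinearMap.comp_apply, ContinuousLinearMap.id_apply] at ha hb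
    rw [← ha, ← hb, hab]
  exact ⟨hinj, (LinearMap.injective_iff_surjective
    (f := (fderiv ℝ (transition I x x') y : E →ₗ[ℝ] E))).1 hinj⟩

lemma norm_localRep {f : M → V} (hf : ∀ x, f x ∈ Metric.sphere (0 : V) 1) (x : M) (y : E) :
    ‖localRep I f x y‖ = 1 := mem_sphere_zero_iff_norm.1 (hf _)

/-- Passing to the preferred chart at a nearby point. -/
lemma overlap_of_mem_source {x x' : M} (hx' : x' ∈ (extChartAt I x).source) :
    extChartAt I x' x' ∈ (extChartAt I x').target ∧
      (extChartAt I x').symm (extChartAt I x' x') ∈ (extChartAt I x).source ∧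
      transition I x' x (extChartAt I x' x') = extChartAt I x x' := by
  refine ⟨mem_extChartAt_target x', ?_, ?_⟩
  · rwa [extChartAt_to_inv]
  · rw [transition, Function.comp_apply, extChartAt_to_inv]

lemma dAt_eq_comp {f : M → V} (hf : ContMDiff I 𝓘(ℝ, V) ∞ f) {x x' : M}
    (hx' : x' ∈ (extChartAt I x).source) :
    dAt I f x' = (fderiv ℝ (localRep I f x) (extChartAt I x x')).comp
      (fderiv ℝ (transition I x' x) (extChartAt I x' x')) := by
  obtain ⟨h1, h2, h3⟩ := overlap_of_mem_source (I := I) hx'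
  rw [dAt, (localRep_eventuallyEq f h1 h2).fderiv_eq, fderiv_comp, h3]
  · rw [h3]
    exact (contDiffAt_localRep hf ((extChartAt I x).map_source hx')).differentiableAt (by simp)
  · exact (contDiffAt_transition h1 h2).differentiableAt (by simp)

lemma injective_fderiv_localRep {f : M → V} (hf : ContMDiff I 𝓘(ℝ, V) ∞ f)
    (hi : ∀ x, Function.Injective (mfderiv I 𝓘(ℝ, V) f x)) {x : M} {y : E}
    (hy : y ∈ (extChartAt I x).target) : Function.Injective (fderiv ℝ (localRep I f x) y) := by
  have hx' : (extChartAt I x).symm y ∈ (extChartAt I x).source := (extChartAt I x).map_target hy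
  have h1 := hi ((extChartAt I x).symm y)
  rw [mfderiv_eq_dAt hf, dAt_eq_comp hf hx', (extChartAt I x).right_inv hy] at h1
  obtain ⟨h2, h3, -⟩ := overlap_of_mem_source (I := I) hx'
  exact Function.Injective.of_comp_right h1 (bijective_fderiv_transition h2 h3).2

lemma secondFundamentalForm_eq {f : M → V} (hf : ContMDiff I 𝓘(ℝ, V) ∞ f) {x x' : M}
    (hx' : x' ∈ (extChartAt I x).source) (u v : E) :
    secondFundamentalForm I f x' u v = sffAt (localRep I f x) (extChartAt I x x')
      (fderiv ℝ (transition I x' x) (extChartAt I x' x') u)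
      (fderiv ℝ (transition I x' x) (extChartAt I x' x') v) := by
  obtain ⟨h1, h2, h3⟩ := overlap_of_mem_source (I := I) hx'
  rw [secondFundamentalForm_eq_sffAt, sffAt_congr (localRep_eventuallyEq f h1 h2),
    sffAt_comp _ ((contDiffAt_transition h1 h2).of_le two_le_infty)
      (bijective_fderiv_transition h1 h2).2, h3]
  rw [h3]
  exact (contDiffAt_localRep hf ((extChartAt I x).map_source hx')).of_le two_le_infty

lemma sqNormSFF_eq {ι : Type*} [Fintype ι] {f : M → V} (hf : ContMDiff I 𝓘(ℝ, V) ∞ f)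
    (hi : ∀ x, Function.Injective (mfderiv I 𝓘(ℝ, V) f x)) {x x' : M}
    (hx' : x' ∈ (extChartAt I x).source) {e : ι → E}
    (he : IsReproducing (fderiv ℝ (localRep I f x) (extChartAt I x x')) e) :
    sqNormSFF I f x' =
      ∑ i, ∑ j, ‖sffAt (localRep I f x) (extChartAt I x x') (e i) (e j)‖ ^ 2 := by
  obtain ⟨h1, h2, h3⟩ := overlap_of_mem_source (I := I) hx'
  have h4 : IsReproducing (dAt I f x') (orthonormalFrame I f x') :=
    isReproducing_orthonormalFrame (by rw [← mfderiv_eq_dAt hf]; exact hi x')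
  rw [dAt_eq_comp hf hx'] at h4
  have h5 := h4.comp (bijective_fderiv_transition h1 h2).2
  rw [he.sum_norm_sq_eq h5]
  simp only [sqNormSFF, secondFundamentalForm_eq hf hx']

end Charts

section Continuity

variable {E : Type*} [NormedAddCommGroup E] [InnerProductSpace ℝ E] [FiniteDimensional ℝ E]
  {H : Type*} [TopologicalSpace H] {I : ModelWithCorners ℝ E H}
  {M : Type*} [TopologicalSpace M] [ChartedSpace H M]
  {V : Type*} [NormedAddCommGroup V] [InnerProductSpace ℝ V] [FiniteDimensional ℝ V]
  [I.Boundaryless] [IsManifold I ∞ M]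

lemma IsMinimalInSphere.continuous_sqNormSFF {f : M → V} (hf : IsMinimalInSphere I f) :
    Continuous (sqNormSFF I f) := by
  rw [continuous_iff_continuousAt]
  intro x
  set g := localRep I f x with hgdef
  set y := extChartAt I x x with hydef
  have hy : y ∈ (extChartAt I x).target := mem_extChartAt_target x
  have hinj (z) (hz : z ∈ (extChartAt I x).target) : Function.Injective (fderiv ℝ g z) :=
    injective_fderiv_localRep hf.contMDiff hf.immersion hz
  let b := stdOrthonormalBasis ℝ V
  let P (z : E) (v : V) : V :=
    v - fderiv ℝ g z (pinv (fderiv ℝ g z) v) - (inner ℝ (g z) v : ℝ) • g z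
  let Q (z : E) : ℝ := ∑ i, ∑ j, ‖P z (fderiv ℝ (fderiv ℝ g) z (pinv (fderiv ℝ g z) (b i))
    (pinv (fderiv ℝ g z) (b j)))‖ ^ 2
  have hQ : sqNormSFF I f =ᶠ[𝓝 x] fun x' => Q (extChartAt I x x') := by
    filter_upwards [extChartAt_source_mem_nhds (I := I) x] with x' hx'
    have hz := (extChartAt I x).map_source hx'
    rw [sqNormSFF_eq hf.contMDiff hf.immersion hx' (isReproducing_pinv (hinj _ hz))]
    simp only [Q, sffAt_apply, ← hgdef]
    refine Finset.sum_congr rfl fun i _ => Finset.sum_congr rfl fun j _ => ?_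
    rw [normalProj_eq_sub (hinj _ hz) (norm_localRep hf.mem_sphere x _)
      (inner_fderiv_self_of_sphere ((contDiffAt_localRep hf.contMDiff hz).differentiableAt
        (by simp)) (Filter.Eventually.of_forall (norm_localRep hf.mem_sphere x)))]
  have hg : ContDiffAt ℝ ∞ g y := contDiffAt_localRep hf.contMDiff hy
  have hg0 : ContinuousAt g y := hg.continuousAt
  have hg1' : ContDiffAt ℝ 1 (fderiv ℝ g) y := hg.fderiv_right two_le_infty
  have hg1 : ContinuousAt (fderiv ℝ g) y := hg1'.continuousAt
  have hg2 : ContinuousAt (fderiv ℝ (fderiv ℝ g)) y :=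
    (hg1'.fderiv_right (m := 0) (by simp)).continuousAt
  have hp : ContinuousAt (fun z => pinv (fderiv ℝ g z)) y :=
    ContinuousAt.comp (g := pinv) (continuousAt_pinv (hinj y hy)) hg1
  have hQc : ContinuousAt Q y := by
    refine tendsto_finsetSum _ fun i _ => tendsto_finsetSum _ fun j _ => ?_
    have hv : ContinuousAt (fun z => fderiv ℝ (fderiv ℝ g) z (pinv (fderiv ℝ g z) (b i))
      (pinv (fderiv ℝ g z) (b j))) y :=
      (hg2.clm_apply (hp.clm_apply continuousAt_const)).clm_apply (hp.clm_apply continuousAt_const)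
    exact (((hv.sub (hg1.clm_apply (hp.clm_apply hv))).sub
      ((ContinuousAt.inner hg0 hv).smul hg0)).norm.pow 2)
  exact (ContinuousAt.comp (f := extChartAt I x) (g := Q) hQc (continuousAt_extChartAt x)).congr
    hQ.symm

end Continuity

section Frames

variable {E : Type*} [NormedAddCommGroup E] [NormedSpace ℝ E] [FiniteDimensional ℝ E]
  {H : Type*} [TopologicalSpace H] {I : ModelWithCorners ℝ E H}
  {M : Type*} [TopologicalSpace M] [ChartedSpace H M]
  {V : Type*} [NormedAddCommGroup V] [InnerProductSpace ℝ V] [FiniteDimensional ℝ V]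

lemma sum_norm_sq_dAt_orthonormalFrame {f : M → V} {x : M}
    (h : Function.Injective (dAt I f x)) :
    ∑ i, ‖dAt I f x (orthonormalFrame I f x i)‖ ^ 2 = (Module.finrank ℝ E : ℝ) := by
  simp only [dAt_orthonormalFrame]
  have hi (i) : ‖(stdOrthonormalBasis ℝ (tangentPlane I f x) i : V)‖ = 1 :=
    (stdOrthonormalBasis ℝ (tangentPlane I f x)).orthonormal.1 i
  simp [hi, finrank_tangentPlane h]

lemma sum_inner_sq_dAt_orthonormalFrame {f : M → V} {x : M}
    (h : Function.Injective (dAt I f x)) :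
    ∑ i, ∑ j, (inner ℝ (dAt I f x (orthonormalFrame I f x i))
      (dAt I f x (orthonormalFrame I f x j)) : ℝ) ^ 2 = (Module.finrank ℝ E : ℝ) := by
  have hi (i j) : (inner ℝ (dAt I f x (orthonormalFrame I f x i))
      (dAt I f x (orthonormalFrame I f x j)) : ℝ) = if i = j then 1 else 0 := by
    simp only [dAt_orthonormalFrame]
    exact (orthonormal_iff_ite.1 (stdOrthonormalBasis ℝ (tangentPlane I f x)).orthonormal) i j
  simp [hi, finrank_tangentPlane h]

lemma IsMinimalInSphere.sum_secondFundamentalForm {f : M → V} (hf : IsMinimalInSphere I f)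
    (hE : Module.finrank ℝ E ≠ 0) (x : M) :
    ∑ i, secondFundamentalForm I f x (orthonormalFrame I f x i) (orthonormalFrame I f x i) = 0 := by
  have h := hf.minimal x
  rw [meanCurvature, smul_eq_zero] at h
  exact h.resolve_left (by simpa using hE)

lemma sqNormSFF_nonneg (f : M → V) (x : M) : 0 ≤ sqNormSFF I f x :=
  Finset.sum_nonneg fun _ _ => Finset.sum_nonneg fun _ _ => by positivity

end Frames

section ProductManifold

variable {k : ℕ} {n : Fin k → ℕ} {M V : Fin k → Type*} [∀ j, TopologicalSpace (M j)]
  [∀ j, ChartedSpace (EuclideanSpace ℝ (Fin (n j))) (M j)]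
  [∀ j, IsManifold (𝓡 (n j)) ∞ (M j)]
  [∀ j, NormedAddCommGroup (V j)] [∀ j, InnerProductSpace ℝ (V j)]
  [∀ j, FiniteDimensional ℝ (V j)] {c : Fin k → ℝ} {f : ∀ j, M j → V j}

lemma localRep_productMap (c : Fin k → ℝ) (f : ∀ j, M j → V j) (x : ∀ j, M j) :
    localRep (prodModel n) (productMap c f) x =
      prodRep c fun j => localRep (𝓡 (n j)) (f j) (x j) := rfl

lemma dAt_injective {j : Fin k} (hf : IsMinimalInSphere (𝓡 (n j)) (f j)) (x : M j) :
    Function.Injective (dAt (𝓡 (n j)) (f j) x) := by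
  rw [← mfderiv_eq_dAt hf.contMDiff]
  exact hf.immersion x

lemma contDiffAt_localRep_self {j : Fin k} (hf : IsMinimalInSphere (𝓡 (n j)) (f j)) (x : M j) :
    ContDiffAt ℝ 2 (localRep (𝓡 (n j)) (f j) x) (extChartAt (𝓡 (n j)) x x) :=
  (contDiffAt_localRep hf.contMDiff (mem_extChartAt_target x)).of_le two_le_infty

lemma dAt_productMap (hf : ∀ j, IsMinimalInSphere (𝓡 (n j)) (f j)) (x : ∀ j, M j) :
    dAt (prodModel n) (productMap c f) x = prodRepL c fun j => dAt (𝓡 (n j)) (f j) (x j) :=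
  fderiv_prodRep fun j => (contDiffAt_localRep_self (hf j) (x j)).differentiableAt (by simp)

lemma isReproducing_dAt_productMap (hf : ∀ j, IsMinimalInSphere (𝓡 (n j)) (f j))
    (hc0 : ∀ j, c j ≠ 0) (x : ∀ j, M j) :
    IsReproducing (dAt (prodModel n) (productMap c f) x)
      (orthonormalFrame (prodModel n) (productMap c f) x) := by
  refine isReproducing_orthonormalFrame ?_
  rw [dAt_productMap hf]
  intro u v huv
  ext1 j
  have := congrArg (fun w : PiLp 2 V => w j) huv
  simp only [prodRepL_apply_apply] at this
  exact dAt_injective (hf j) (x j) (smul_right_injective _ (hc0 j) this)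

lemma sum_secondFundamentalForm_productMap (hf : ∀ j, IsMinimalInSphere (𝓡 (n j)) (f j))
    (hn : ∀ j, 0 < n j) (hc0 : ∀ j, c j ≠ 0) (hc : ∑ j, c j ^ 2 = 1) (x : ∀ j, M j) (j : Fin k) :
    (∑ i, secondFundamentalForm (prodModel n) (productMap c f) x
      (orthonormalFrame (prodModel n) (productMap c f) x i)
      (orthonormalFrame (prodModel n) (productMap c f) x i)) j =
      (c j * ((∑ l, n l : ℕ) : ℝ) - (c j)⁻¹ * n j) • f j (x j) := by
  have hg (l) := contDiffAt_localRep_self (hf l) (x l)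
  have hs (l) : ∀ᶠ z in 𝓝 (extChartAt (𝓡 (n l)) (x l) (x l)),
      ‖localRep (𝓡 (n l)) (f l) (x l) z‖ = 1 :=
    Filter.Eventually.of_forall (norm_localRep (hf l).mem_sphere (x l))
  have hD := isReproducing_dAt_productMap (c := c) hf hc0 x
  have hP := isReproducing_prodFrame (V := V) hc0 fun l =>
    isReproducing_orthonormalFrame (dAt_injective (hf l) (x l))
  rw [← dAt_productMap hf] at hP
  simp only [secondFundamentalForm_eq_sffAt]
  have h1 := hD.sum_bilin_eq hP ((ContinuousLinearMap.coeLM ℝ).comp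
    (sffAt (localRep (prodModel n) (productMap c f) x)
      (extChartAt (prodModel n) x x)).toLinearMap)
  simp only [LinearMap.comp_apply, ContinuousLinearMap.coe_coe, ContinuousLinearMap.coeLM_apply]
    at h1
  rw [h1]
  have h2 := sum_sffAt_prodFrame_apply hc0 hc hg hs
    (fun l => orthonormalFrame (𝓡 (n l)) (f l) (x l)) j
  refine h2.trans ?_
  have h3 (l) := sum_norm_sq_dAt_orthonormalFrame (dAt_injective (hf l) (x l))
  have h4 := (hf j).sum_secondFundamentalForm (by simpa using (hn j).ne') (x j)
  simp only [secondFundamentalForm_eq_sffAt] at h4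
  simp only [dAt] at h3
  rw [h4, localRep_extChartAt (mem_extChartAt_source (x j))]
  simp only [h3, finrank_euclideanSpace, Fintype.card_fin]
  simp

lemma sq_coeff_eq (hf : ∀ j, IsMinimalInSphere (𝓡 (n j)) (f j)) (hn : ∀ j, 0 < n j)
    [∀ j, Nonempty (M j)] (hc : IsMinimalProduct n c f) (j : Fin k) :
    c j ^ 2 = n j / ((∑ l, n l : ℕ) : ℝ) := by
  have hN : 0 < ∑ l, n l := Finset.sum_pos (fun l _ => hn l) ⟨j, Finset.mem_univ j⟩
  let x : ∀ j, M j := fun j => Classical.arbitrary _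
  have h1 := sum_secondFundamentalForm_productMap hf hn hc.ne_zero hc.sum_sq x j
  rw [hc.minimal.sum_secondFundamentalForm] at h1
  · have hne : f j (x j) ≠ 0 := by
      intro h
      have := (hf j).mem_sphere (x j)
      simp [h] at this
    have h2 := (smul_eq_zero.1 h1.symm).resolve_right hne
    have := hc.ne_zero j
    have hN' : ((∑ l, n l : ℕ) : ℝ) ≠ 0 := by exact_mod_cast hN.ne'
    rw [eq_div_iff hN']
    field_simp at h2
    linarith
  · rw [Module.finrank_pi_fintype]
    simpa using hN.ne'

lemma sqNormSFF_productMap (hf : ∀ j, IsMinimalInSphere (𝓡 (n j)) (f j)) (hn : ∀ j, 0 < n j)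
    [∀ j, Nonempty (M j)] (hc : IsMinimalProduct n c f) (x : ∀ j, M j) :
    sqNormSFF (prodModel n) (productMap c f) x = (k - 1) * ((∑ l, n l : ℕ) : ℝ) +
      ∑ j, ((∑ l, n l : ℕ) : ℝ) / n j * sqNormSFF (𝓡 (n j)) (f j) (x j) := by
  have hg (l) := contDiffAt_localRep_self (hf l) (x l)
  have hs (l) : ∀ᶠ z in 𝓝 (extChartAt (𝓡 (n l)) (x l) (x l)),
      ‖localRep (𝓡 (n l)) (f l) (x l) z‖ = 1 :=
    Filter.Eventually.of_forall (norm_localRep (hf l).mem_sphere (x l))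
  have hD := isReproducing_dAt_productMap (c := c) hf hc.ne_zero x
  have hP := isReproducing_prodFrame (V := V) hc.ne_zero fun l =>
    isReproducing_orthonormalFrame (dAt_injective (hf l) (x l))
  rw [← dAt_productMap hf] at hP
  simp only [sqNormSFF, secondFundamentalForm_eq_sffAt]
  rw [hD.sum_norm_sq_eq hP]
  refine (sum_norm_sq_sffAt_prodFrame hc.ne_zero hc.sum_sq hg hs
    (fun l => orthonormalFrame (𝓡 (n l)) (f l) (x l))).trans ?_
  have h3 (l) := sum_inner_sq_dAt_orthonormalFrame (dAt_injective (hf l) (x l))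
  simp only [dAt] at h3
  simp only [h3, sq_coeff_eq hf hn hc, finrank_euclideanSpace, Fintype.card_fin, inv_div,
    Finset.sum_add_distrib, sub_mul, Finset.sum_sub_distrib, one_mul]
  have h4 : ∑ j, ((∑ l, n l : ℕ) : ℝ) / n j * n j = k * ((∑ l, n l : ℕ) : ℝ) := by
    rw [Finset.sum_congr rfl fun j _ => div_mul_cancel₀ _ (by exact_mod_cast (hn j).ne')]
    simp
  rw [h4, ← Nat.cast_sum]
  ring

end ProductManifold

section Gluing

variable {X : Type*} [TopologicalSpace X] [SecondCountableTopology X] [MeasurableSpace X]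
  [OpensMeasurableSpace X]

lemma exists_countable_partition [Nonempty X] {U : X → Set X} (hU : ∀ x, IsOpen (U x))
    (hxU : ∀ x, x ∈ U x) : ∃ (u : ℕ → X) (D : ℕ → Set X), (∀ i, MeasurableSet (D i)) ∧
      Pairwise (Function.onFun Disjoint D) ∧ ⋃ i, D i = Set.univ ∧ ∀ i, D i ⊆ U (u i) := by
  obtain ⟨s, hs, hsU⟩ :=
    TopologicalSpace.countable_cover_nhds (fun x => (hU x).mem_nhds (hxU x))
  have hne : s.Nonempty := by
    by_contra h
    rw [Set.not_nonempty_iff_eq_empty] at h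
    exact Set.empty_ne_univ (by simpa [h] using hsU)
  obtain ⟨u, rfl⟩ := hs.exists_eq_range hne
  refine ⟨u, disjointed fun i => U (u i),
    fun i => MeasurableSet.disjointed (fun i => (hU _).measurableSet) i,
    disjoint_disjointed _, ?_, fun i => disjointed_subset _ i⟩
  rw [iUnion_disjointed]
  simpa using hsU

lemma measure_eq_tsum_partition (μ : Measure X) {D : ℕ → Set X} (hD : ∀ i, MeasurableSet (D i))
    (hdisj : Pairwise (Function.onFun Disjoint D)) (hcov : ⋃ i, D i = Set.univ) {A : Set X}
    (hA : MeasurableSet A) : μ A = ∑' i, μ (A ∩ D i) := by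
  rw [← measure_iUnion (fun i j hij => (hdisj hij).mono Set.inter_subset_right
    Set.inter_subset_right) (fun i => hA.inter (hD i)), ← Set.inter_iUnion, hcov, Set.inter_univ]

/-- Measures that agree on the overlaps of an open cover are the restrictions of their
supremum. -/
lemma iSup_restrict_eq_of_agree {U : X → Set X} (hU : ∀ x, IsOpen (U x)) (hxU : ∀ x, x ∈ U x)
    {m : X → Measure X} (hm : ∀ x, m x (U x)ᶜ = 0)
    (hag : ∀ x x' A, MeasurableSet A → A ⊆ U x → A ⊆ U x' → m x A = m x' A) (x : X) :
    (⨆ x, m x).restrict (U x) = m x := by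
  have : Nonempty X := ⟨x⟩
  obtain ⟨u, D, hD, hdisj, hcov, hDU⟩ := exists_countable_partition hU hxU
  set ν : Measure X := Measure.sum fun i => (m (u i)).restrict (D i)
  have hν {A : Set X} (hA : MeasurableSet A) : ν A = ∑' i, m (u i) (A ∩ D i) := by
    rw [Measure.sum_apply _ hA]
    exact tsum_congr fun i => Measure.restrict_apply hA
  have hinter (z : X) (B : Set X) : m z B = m z (B ∩ U z) := by
    refine le_antisymm ?_ (measure_mono Set.inter_subset_left)
    calc m z B ≤ m z (B ∩ U z) + m z (B ∩ (U z)ᶜ) := measure_le_inter_add_sdiff _ _ _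
      _ = m z (B ∩ U z) := by
        rw [measure_mono_null Set.inter_subset_right (hm z), add_zero]
  have hle : ⨆ x, m x ≤ ν := by
    refine iSup_le fun z => Measure.le_iff.2 fun B hB => ?_
    rw [hinter, measure_eq_tsum_partition _ hD hdisj hcov (hB.inter (hU z).measurableSet), hν hB]
    refine ENNReal.tsum_le_tsum fun i => ?_
    rw [hag z (u i) _ ((hB.inter (hU z).measurableSet).inter (hD i))
      (fun a ha => ha.1.2) (fun a ha => hDU i ha.2)]
    exact measure_mono (Set.inter_subset_inter_left _ Set.inter_subset_left)
  ext A hA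
  rw [Measure.restrict_apply hA, hinter x A]
  have hA' : MeasurableSet (A ∩ U x) := hA.inter (hU x).measurableSet
  refine le_antisymm ((hle _).trans ?_) (le_iSup m x _)
  rw [hν hA', measure_eq_tsum_partition (m x) hD hdisj hcov hA']
  exact (tsum_congr fun i => hag _ _ _ (hA'.inter (hD i)) (fun a ha => hDU i ha.2)
    (fun a ha => ha.1.2)).le

lemma iSup_eq_of_eq_restrict {U : X → Set X} (hU : ∀ x, IsOpen (U x)) (hxU : ∀ x, x ∈ U x)
    {m : X → Measure X} {μ : Measure X} (hm : ∀ x, m x = μ.restrict (U x)) :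
    ⨆ x, m x = μ := by
  refine le_antisymm (iSup_le fun x => (hm x).trans_le Measure.restrict_le_self) ?_
  rcases isEmpty_or_nonempty X with h | h
  · rw [Measure.eq_zero_of_isEmpty μ]
    exact Measure.zero_le _
  obtain ⟨u, D, hD, hdisj, hcov, hDU⟩ := exists_countable_partition hU hxU
  refine Measure.le_iff.2 fun A hA => ?_
  rw [measure_eq_tsum_partition _ hD hdisj hcov hA,
    measure_eq_tsum_partition (⨆ x, m x) hD hdisj hcov hA]
  refine ENNReal.tsum_le_tsum fun i => ?_
  calc μ (A ∩ D i) = m (u i) (A ∩ D i) := by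
        rw [hm, Measure.restrict_apply (hA.inter (hD i)),
          Set.inter_eq_left.2 fun a ha => hDU i ha.2]
    _ ≤ (⨆ x, m x) (A ∩ D i) := le_iSup m (u i) _

end Gluing

section Gram

variable {E : Type*} [NormedAddCommGroup E] [NormedSpace ℝ E] [FiniteDimensional ℝ E]
  {V : Type*} [NormedAddCommGroup V] [InnerProductSpace ℝ V]
  {ι κ : Type*} [Fintype ι] [DecidableEq ι] [Fintype κ] [DecidableEq κ]

/-- The volume density, with respect to a basis of `E`, of the metric that `D` induces on `E`. -/
def gramDensity (b : Module.Basis ι ℝ E) (D : E →L[ℝ] V) : ℝ :=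
  Real.sqrt (Matrix.gram ℝ fun i => D (b i)).det

lemma det_gram_comp (b : Module.Basis ι ℝ E) (D : E →L[ℝ] V) (T : E →ₗ[ℝ] E) :
    (Matrix.gram ℝ fun i => D (T (b i))).det =
      LinearMap.det T ^ 2 * (Matrix.gram ℝ fun i => D (b i)).det := by
  have h : (Matrix.gram ℝ fun i => D (T (b i))) = (LinearMap.toMatrix b b T).transpose *
      (Matrix.gram ℝ fun i => D (b i)) * LinearMap.toMatrix b b T := by
    ext i j
    have hT (i) : D (T (b i)) = ∑ l, LinearMap.toMatrix b b T l i • D (b l) := by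
      have := congrArg D (b.sum_repr (T (b i)))
      rw [map_sum] at this
      simpa only [LinearMap.toMatrix_apply, map_smul] using this.symm
    simp only [Matrix.gram_apply, Matrix.mul_apply, Matrix.transpose_apply, hT, sum_inner,
      inner_sum, inner_smul_left, inner_smul_right, conj_trivial, Finset.sum_mul, Finset.mul_sum]
    exact Finset.sum_congr rfl fun _ _ => Finset.sum_congr rfl fun _ _ => by ring
  rw [h, Matrix.det_mul, Matrix.det_mul, Matrix.det_transpose, LinearMap.det_toMatrix]
  ring

lemma gramDensity_comp (b : Module.Basis ι ℝ E) (D : E →L[ℝ] V) (T : E →L[ℝ] E) :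
    gramDensity b (D.comp T) = |T.det| * gramDensity b D := by
  have := det_gram_comp b D T.toLinearMap
  simp only [ContinuousLinearMap.coe_coe] at this
  simp only [gramDensity, ContinuousLinearMap.comp_apply, this]
  rw [Real.sqrt_mul (sq_nonneg _), Real.sqrt_sq_eq_abs]

lemma gramDensity_nonneg (b : Module.Basis ι ℝ E) (D : E →L[ℝ] V) : 0 ≤ gramDensity b D :=
  Real.sqrt_nonneg _

lemma gramDensity_pos (b : Module.Basis ι ℝ E) {D : E →L[ℝ] V} (hD : Function.Injective D) :
    0 < gramDensity b D := by
  refine Real.sqrt_pos.2 (Matrix.PosDef.det_pos (Matrix.posDef_gram_of_linearIndependent ?_))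
  exact b.linearIndependent.map' (D : E →ₗ[ℝ] V) (LinearMap.ker_eq_bot.2 hD)

lemma continuous_gramDensity (b : Module.Basis ι ℝ E) :
    Continuous (gramDensity b : (E →L[ℝ] V) → ℝ) := by
  refine Real.continuous_sqrt.comp (Continuous.matrix_det (continuous_matrix fun i j => ?_))
  simp only [Matrix.gram_apply]
  fun_prop

variable [MeasurableSpace E] [BorelSpace E]

lemma addHaar_eq_smul (b b' : Module.Basis ι ℝ E) :
    b.addHaar = ENNReal.ofReal |b.det b'| • b'.addHaar := by
  set r : NNReal := Real.toNNReal |b.det b'| with hr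
  have hne : r ≠ 0 := by
    simpa [hr] using (b.isUnit_det b').ne_zero
  have h : b'.addHaar = r⁻¹ • b.addHaar := by
    rw [Module.Basis.addHaar_eq_iff, Measure.coe_nnreal_smul_apply,
      Module.Basis.coe_parallelepiped, Measure.addHaar_parallelepiped, ENNReal.ofReal, ← hr,
      ← ENNReal.coe_mul, inv_mul_cancel₀ hne, ENNReal.coe_one]
  change b.addHaar = r • b'.addHaar
  rw [h, smul_smul, mul_inv_cancel₀ hne, one_smul]

lemma withDensity_gramDensity_eq (b : Module.Basis ι ℝ E) (b' : Module.Basis κ ℝ E)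
    (D : E → E →L[ℝ] V) (s : Set E) :
    (b.addHaar.restrict s).withDensity (fun y => ENNReal.ofReal (gramDensity b (D y))) =
      (b'.addHaar.restrict s).withDensity (fun y => ENNReal.ofReal (gramDensity b' (D y))) := by
  set e := b'.indexEquiv b
  set b₁ := b'.reindex e
  have h1 : b₁.addHaar = b'.addHaar := b'.addHaar_reindex e
  have h2 (y) : gramDensity b' (D y) = gramDensity b₁ (D y) := by
    unfold gramDensity
    congr 1
    rw [← Matrix.det_submatrix_equiv_self e.symm]
    congr 1
    ext i j
    simp [Matrix.gram_apply, b₁]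
  have h3 (y) : gramDensity b₁ (D y) = |b.det b₁| * gramDensity b (D y) := by
    set T : E →ₗ[ℝ] E := (b.equiv b₁ (Equiv.refl ι)).toLinearMap with hT
    have hb (i) : T (b i) = b₁ i := by simp [T]
    have hdet : LinearMap.det T = b.det b₁ := by
      have := b.det_comp T b
      rw [Module.Basis.det_self, mul_one] at this
      rw [← this]
      congr 1
      ext i
      simp [hb]
    have := det_gram_comp b (D y) T
    simp only [hb] at this
    simp only [gramDensity, this]
    rw [Real.sqrt_mul (sq_nonneg _), Real.sqrt_sq_eq_abs, hdet]
  simp only [h2, h3, ← h1, ENNReal.ofReal_mul (abs_nonneg _)]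
  rw [addHaar_eq_smul b b₁, Measure.restrict_smul, withDensity_smul_measure,
    ← withDensity_smul' _ _ ENNReal.ofReal_ne_top]
  rfl

end Gram

section PiMeasure

variable {ι : Type*} [Fintype ι] {E : ι → Type*} [∀ j, NormedAddCommGroup (E j)]
  [∀ j, NormedSpace ℝ (E j)] [∀ j, FiniteDimensional ℝ (E j)] [∀ j, MeasurableSpace (E j)]
  [∀ j, BorelSpace (E j)] {κ : ι → Type*} [∀ j, Fintype (κ j)]

lemma addHaar_pi_basis (b : ∀ j, Module.Basis (κ j) ℝ (E j)) :
    (Pi.basis b).addHaar = Measure.pi fun j => (b j).addHaar := by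
  rw [Module.Basis.addHaar_eq_iff, Module.Basis.coe_parallelepiped, parallelepiped_basis_eq]
  have : {x : ∀ j, E j | ∀ i, (Pi.basis b).repr x i ∈ Set.Icc (0 : ℝ) 1} =
      Set.univ.pi fun j => parallelepiped (b j) := by
    ext x
    simp only [parallelepiped_basis_eq, Set.mem_pi, Set.mem_univ, true_imp_iff, Pi.basis_repr,
      Sigma.forall]
    rfl
  rw [this, Measure.pi_pi]
  simp [Module.Basis.addHaar_self]

lemma det_blockDiagonal' [LinearOrder ι] [∀ j, DecidableEq (κ j)]
    (A : ∀ j, Matrix (κ j) (κ j) ℝ) : (Matrix.blockDiagonal' A).det = ∏ j, (A j).det := by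
  rw [(Matrix.blockTriangular_blockDiagonal' A).det_fintype]
  refine Finset.prod_congr rfl fun j _ => ?_
  rw [← Matrix.det_submatrix_equiv_self (Equiv.sigmaSubtype (β := κ) j).symm]
  congr 1
  ext a b
  exact Matrix.blockDiagonal'_apply_eq A j a b

lemma gramDensity_prodRepL {V : ι → Type*} [∀ j, NormedAddCommGroup (V j)]
    [∀ j, InnerProductSpace ℝ (V j)] [∀ j, FiniteDimensional ℝ (V j)] [LinearOrder ι]
    [∀ j, DecidableEq (κ j)]
    (b : ∀ j, Module.Basis (κ j) ℝ (E j)) (c : ι → ℝ) (D : ∀ j, E j →L[ℝ] V j) :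
    gramDensity (Pi.basis b) (prodRepL c D) =
      ∏ j, |c j| ^ Fintype.card (κ j) * gramDensity (b j) (D j) := by
  have h : (Matrix.gram ℝ fun p => prodRepL c D (Pi.basis b p)) =
      Matrix.blockDiagonal' fun j => c j ^ 2 • Matrix.gram ℝ fun i => D j (b j i) := by
    ext ⟨j, i⟩ ⟨l, m⟩
    rw [Matrix.gram_apply, Pi.basis_apply, Pi.basis_apply, inner_prodRepL_single]
    rcases eq_or_ne j l with rfl | hjl
    · rw [Matrix.blockDiagonal'_apply_eq]
      simp [Matrix.gram_apply]
    · rw [Matrix.blockDiagonal'_apply_ne _ _ _ hjl]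
      simp [Pi.single_eq_of_ne hjl]
  unfold gramDensity
  rw [h, det_blockDiagonal']
  rw [Real.sqrt_prod]
  · refine Finset.prod_congr rfl fun j _ => ?_
    rw [Matrix.det_smul, Real.sqrt_mul (by positivity), ← pow_mul, mul_comm 2, pow_mul,
      Real.sqrt_sq_eq_abs, abs_pow]
  · intro j _
    rw [Matrix.det_smul]
    exact mul_nonneg (by positivity) (Matrix.posSemidef_gram ℝ _).det_nonneg

lemma lintegral_fin_prod {k : ℕ} {X : Fin k → Type*} {mX : ∀ i, MeasurableSpace (X i)}
    {μ : ∀ i, Measure (X i)} [∀ i, SigmaFinite (μ i)] {g : ∀ i, X i → ℝ≥0∞}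
    (hg : ∀ i, AEMeasurable (g i) (μ i)) :
    ∫⁻ x : ∀ i, X i, ∏ i, g i (x i) ∂(Measure.pi μ) = ∏ i, ∫⁻ x, g i x ∂(μ i) := by
  induction k with
  | zero => simp
  | succ k ih =>
    have hae : AEMeasurable (fun x : ∀ i : Fin k, X (Fin.succAbove 0 i) =>
        ∏ i, g (Fin.succAbove 0 i) (x i)) (Measure.pi fun i => μ (Fin.succAbove 0 i)) :=
      Finset.aemeasurable_fun_prod _ fun i _ =>
        (hg (Fin.succAbove 0 i)).comp_quasiMeasurePreserving
          (Measure.quasiMeasurePreserving_eval (fun i : Fin k => μ (Fin.succAbove 0 i)) i)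
    calc _ = ∫⁻ x, (fun p : X 0 × (∀ i : Fin k, X (Fin.succAbove 0 i)) =>
              g 0 p.1 * ∏ i : Fin k, g (Fin.succAbove 0 i) (p.2 i))
              (MeasurableEquiv.piFinSuccAbove X 0 x) ∂(Measure.pi μ) := by
          refine lintegral_congr fun x => ?_
          rw [Fin.prod_univ_succAbove _ 0]
          rfl
      _ = ∫⁻ x : X 0 × (∀ i : Fin k, X (Fin.succAbove 0 i)),
            g 0 x.1 * ∏ i : Fin k, g (Fin.succAbove 0 i) (x.2 i)
            ∂((μ 0).prod (Measure.pi fun i => μ (Fin.succAbove 0 i))) :=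
          (measurePreserving_piFinSuccAbove μ 0).lintegral_comp_emb
            (MeasurableEquiv.measurableEmbedding _)
            (fun x : X 0 × (∀ i : Fin k, X (Fin.succAbove 0 i)) =>
              g 0 x.1 * ∏ i : Fin k, g (Fin.succAbove 0 i) (x.2 i))
      _ = (∫⁻ x, g 0 x ∂μ 0) *
            ∏ i : Fin k, ∫⁻ x, g (Fin.succAbove 0 i) x ∂(μ (Fin.succAbove 0 i)) := by
          rw [← ih fun i => hg (Fin.succAbove 0 i), ← lintegral_prod_mul (hg 0) hae]
      _ = ∏ i, ∫⁻ x, g i x ∂(μ i) := by rw [Fin.prod_univ_succAbove _ 0]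

end PiMeasure

section ChartVolume

variable {E : Type*} [NormedAddCommGroup E] [NormedSpace ℝ E] [FiniteDimensional ℝ E]
  [MeasurableSpace E] [BorelSpace E]
  {H : Type*} [TopologicalSpace H] {I : ModelWithCorners ℝ E H} [I.Boundaryless]
  {M : Type*} [TopologicalSpace M] [ChartedSpace H M] [MeasurableSpace M] [BorelSpace M]
  {V : Type*} [NormedAddCommGroup V] [InnerProductSpace ℝ V] [FiniteDimensional ℝ V]

lemma measurableSet_extChartAt_target (x : M) : MeasurableSet (extChartAt I x).target :=
  (isOpen_extChartAt_target x).measurableSet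

lemma measurableSet_symm_preimage (x : M) {A : Set M} (hA : MeasurableSet A) :
    MeasurableSet ((extChartAt I x).symm ⁻¹' A ∩ (extChartAt I x).target) := by
  have h := (continuousOn_extChartAt_symm (I := I) x).domRestrict.measurable hA
  have h2 := (MeasurableEmbedding.subtype_coe
    (measurableSet_extChartAt_target (I := I) x)).measurableSet_image.2 h
  convert h2 using 1
  ext y
  simp [and_comm]

lemma chartVolume_apply {ι : Type*} [Fintype ι] [DecidableEq ι] (b : Module.Basis ι ℝ E)
    (f : M → V) (x : M) {A : Set M} (hA : MeasurableSet A) :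
    chartVolume I f x A =
      ∫⁻ y in (extChartAt I x).symm ⁻¹' A ∩ (extChartAt I x).target,
        ENNReal.ofReal (gramDensity b (fderiv ℝ (localRep I f x) y)) ∂b.addHaar := by
  have h := withDensity_gramDensity_eq (Module.finBasis ℝ E) b
    (fun y => fderiv ℝ (localRep I f x) y) (extChartAt I x).target
  unfold chartVolume
  unfold gramDensity at h
  rw [h, Measure.map_apply_of_aemeasurable _ hA, withDensity_apply', Measure.restrict_restrict'
    (measurableSet_extChartAt_target x)]
  · rfl
  · exact ((continuousOn_extChartAt_symm x).aemeasurable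
      (measurableSet_extChartAt_target x)).mono_ac (withDensity_absolutelyContinuous _ _)

lemma chartVolume_compl_source (f : M → V) (x : M) :
    chartVolume I f x (extChartAt I x).sourceᶜ = 0 := by
  rw [chartVolume_apply (Module.finBasis ℝ E) f x (isOpen_extChartAt_source x).measurableSet.compl]
  have : (extChartAt I x).symm ⁻¹' (extChartAt I x).sourceᶜ ∩ (extChartAt I x).target = ∅ := by
    ext y
    simp only [Set.mem_inter_iff, Set.mem_preimage, Set.mem_compl_iff, Set.mem_empty_iff_false,
      iff_false, not_and]
    exact fun h h' => h ((extChartAt I x).map_target h')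
  rw [this]
  simp

variable [IsManifold I ∞ M]

lemma chartVolume_agree {f : M → V} (hf : ContMDiff I 𝓘(ℝ, V) ∞ f) (x x' : M) {A : Set M}
    (hA : MeasurableSet A) (hx : A ⊆ (extChartAt I x).source) (hx' : A ⊆ (extChartAt I x').source) :
    chartVolume I f x A = chartVolume I f x' A := by
  set b := Module.finBasis ℝ E
  rw [chartVolume_apply b f x hA, chartVolume_apply b f x' hA]
  set s := (extChartAt I x).symm ⁻¹' A ∩ (extChartAt I x).target with hs
  have himg : (extChartAt I x').symm ⁻¹' A ∩ (extChartAt I x').target = transition I x x' '' s := by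
    ext z
    constructor
    · rintro ⟨hz, hz'⟩
      have h1 := hx hz
      refine ⟨extChartAt I x ((extChartAt I x').symm z), ⟨?_, (extChartAt I x).map_source h1⟩, ?_⟩
      · rw [Set.mem_preimage, (extChartAt I x).left_inv h1]
        exact hz
      · rw [transition, Function.comp_apply, (extChartAt I x).left_inv h1,
          (extChartAt I x').right_inv hz']
    · rintro ⟨y, ⟨hy, hy'⟩, rfl⟩
      have h1 := hx' hy
      refine ⟨?_, (extChartAt I x').map_source h1⟩
      rw [Set.mem_preimage, transition, Function.comp_apply, (extChartAt I x').left_inv h1]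
      exact hy
  have hinj : Set.InjOn (transition I x x') s := by
    intro y hy z hz hyz
    have h := congrArg (extChartAt I x').symm hyz
    simp only [transition, Function.comp_apply] at h
    rw [(extChartAt I x').left_inv (hx' hy.1), (extChartAt I x').left_inv (hx' hz.1)] at h
    exact (extChartAt I x).symm.injOn hy.2 hz.2 h
  rw [himg, lintegral_image_eq_lintegral_abs_det_fderiv_mul _ (measurableSet_symm_preimage x hA)
    (fun y hy => ((contDiffAt_transition hy.2 (hx' hy.1)).differentiableAt
      (by simp)).hasFDerivAt.hasFDerivWithinAt) hinj]
  refine setLIntegral_congr_fun (measurableSet_symm_preimage x hA) fun y hy => ?_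
  have ht : transition I x x' y ∈ (extChartAt I x').target :=
    (extChartAt I x').map_source (hx' hy.1)
  rw [← ENNReal.ofReal_mul (abs_nonneg _), ← gramDensity_comp,
    (localRep_eventuallyEq f hy.2 (hx' hy.1)).fderiv_eq, fderiv_comp]
  · exact (contDiffAt_localRep hf ht).differentiableAt (by simp)
  · exact (contDiffAt_transition hy.2 (hx' hy.1)).differentiableAt (by simp)

variable [SecondCountableTopology M]

lemma inducedVolume_restrict {f : M → V} (hf : ContMDiff I 𝓘(ℝ, V) ∞ f) (x : M) :
    (inducedVolume I f).restrict (extChartAt I x).source = chartVolume I f x :=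
  iSup_restrict_eq_of_agree (fun x => isOpen_extChartAt_source x)
    (fun x => mem_extChartAt_source x) (chartVolume_compl_source f)
    (fun x x' _ hA hx hx' => chartVolume_agree hf x x' hA hx hx') x

lemma continuousOn_gramDensity_localRep {ι : Type*} [Fintype ι] [DecidableEq ι]
    (b : Module.Basis ι ℝ E) {f : M → V} (hf : ContMDiff I 𝓘(ℝ, V) ∞ f) (x : M) :
    ContinuousOn (fun y => gramDensity b (fderiv ℝ (localRep I f x) y))
      (extChartAt I x).target := by
  intro y hy
  have h : ContinuousAt (fderiv ℝ (localRep I f x)) y :=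
    ((contDiffAt_localRep hf hy).fderiv_right (m := 0) (by simp)).continuousAt
  exact (ContinuousAt.comp (continuous_gramDensity b).continuousAt h).continuousWithinAt

lemma isFiniteMeasure_inducedVolume [CompactSpace M] {f : M → V}
    (hf : ContMDiff I 𝓘(ℝ, V) ∞ f) : IsFiniteMeasure (inducedVolume I f) := by
  refine ⟨?_⟩
  refine (isCompact_univ (X := M)).measure_lt_top_of_nhdsWithin fun x _ => ?_
  rw [nhdsWithin_univ]
  set b := Module.finBasis ℝ E
  set y := extChartAt I x x
  have hy : y ∈ (extChartAt I x).target := mem_extChartAt_target x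
  set ρ := fun y => gramDensity b (fderiv ℝ (localRep I f x) y)
  have hρ : ∀ᶠ z in 𝓝 y, ρ z < ρ y + 1 :=
    ((continuousOn_gramDensity_localRep b hf x).continuousAt
      ((isOpen_extChartAt_target x).mem_nhds hy)).eventually_lt_const (lt_add_one _)
  obtain ⟨K, hK, hKm, hKf⟩ : ∃ K ∈ 𝓝 y, MeasurableSet K ∧ b.addHaar K < ⊤ :=
    ⟨Metric.ball y 1, Metric.ball_mem_nhds y one_pos, measurableSet_ball, measure_ball_lt_top⟩
  obtain ⟨O, hOsub, hO, hyO⟩ := mem_nhds_iff.1 (Filter.inter_mem hK hρ)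
  refine ⟨(extChartAt I x).source ∩ extChartAt I x ⁻¹' O, ?_, ?_⟩
  · exact Filter.inter_mem (extChartAt_source_mem_nhds x)
      ((continuousAt_extChartAt x).preimage_mem_nhds (hO.mem_nhds hyO))
  · have hopen : IsOpen ((extChartAt I x).source ∩ extChartAt I x ⁻¹' O) :=
      (continuousOn_extChartAt x).isOpen_inter_preimage (isOpen_extChartAt_source x) hO
    rw [← Set.inter_eq_left.2 (Set.inter_subset_left (s := (extChartAt I x).source)
      (t := extChartAt I x ⁻¹' O)), ← Measure.restrict_apply hopen.measurableSet,
      inducedVolume_restrict hf, chartVolume_apply b f x hopen.measurableSet]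
    calc _ ≤ ∫⁻ z in O, ENNReal.ofReal (ρ z) ∂b.addHaar := by
          refine lintegral_mono_set ?_
          rintro z ⟨hz, hz'⟩
          have := hz.2
          rwa [Set.mem_preimage, (extChartAt I x).right_inv hz'] at this
      _ ≤ ∫⁻ z in O, ENNReal.ofReal (ρ y + 1) ∂b.addHaar :=
          setLIntegral_mono' hO.measurableSet fun z hz =>
            ENNReal.ofReal_le_ofReal (le_of_lt (hOsub hz).2)
      _ = ENNReal.ofReal (ρ y + 1) * b.addHaar O := by simp
      _ < ⊤ := ENNReal.mul_lt_top ENNReal.ofReal_lt_top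
          ((measure_mono fun z hz => (hOsub hz).1).trans_lt hKf)

lemma isOpenPosMeasure_inducedVolume {f : M → V} (hf : ContMDiff I 𝓘(ℝ, V) ∞ f)
    (hi : ∀ x, Function.Injective (mfderiv I 𝓘(ℝ, V) f x)) :
    (inducedVolume I f).IsOpenPosMeasure := by
  refine ⟨fun O hO ⟨x, hx⟩ h0 => ?_⟩
  set b := Module.finBasis ℝ E
  have h1 : chartVolume I f x O = 0 :=
    le_antisymm ((le_iSup (chartVolume I f) x O).trans h0.le) zero_le
  have hs : IsOpen ((extChartAt I x).symm ⁻¹' O ∩ (extChartAt I x).target) := by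
    rw [Set.inter_comm]
    exact (continuousOn_extChartAt_symm x).isOpen_inter_preimage (isOpen_extChartAt_target x) hO
  have hne : ((extChartAt I x).symm ⁻¹' O ∩ (extChartAt I x).target).Nonempty :=
    ⟨extChartAt I x x, by rwa [Set.mem_preimage, extChartAt_to_inv], mem_extChartAt_target x⟩
  rw [chartVolume_apply b f x hO.measurableSet, setLIntegral_eq_zero_iff' hs.measurableSet] at h1
  · refine hs.measure_ne_zero b.addHaar hne (measure_mono_null (fun y hy => ?_) h1)
    simp only [Set.mem_compl_iff, Set.mem_ofPred_eq]
    intro h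
    have := h hy
    rw [ENNReal.ofReal_eq_zero] at this
    exact absurd (gramDensity_pos b (injective_fderiv_localRep hf hi hy.2)) (not_lt.2 this)
  · exact ENNReal.measurable_ofReal.comp_aemeasurable
      (((continuousOn_gramDensity_localRep b hf x).mono Set.inter_subset_right).aemeasurable
        hs.measurableSet)

end ChartVolume

section ProductVolume

variable {k : ℕ} {n : Fin k → ℕ} {M V : Fin k → Type*} [∀ j, TopologicalSpace (M j)]
  [∀ j, ChartedSpace (EuclideanSpace ℝ (Fin (n j))) (M j)]
  [∀ j, IsManifold (𝓡 (n j)) ∞ (M j)] [∀ j, MeasurableSpace (M j)] [∀ j, BorelSpace (M j)]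
  [∀ j, NormedAddCommGroup (V j)] [∀ j, InnerProductSpace ℝ (V j)]
  [∀ j, FiniteDimensional ℝ (V j)] {c : Fin k → ℝ} {f : ∀ j, M j → V j}
  [∀ j, CompactSpace (M j)] [∀ j, SecondCountableTopology (M j)]

instance boundaryless_prodModel : (prodModel n).Boundaryless where
  range_eq_univ := Set.range_eq_univ.2 Function.surjective_id

lemma extChartAt_prodModel_source (x : ∀ j, M j) :
    (extChartAt (prodModel n) x).source =
      Set.univ.pi fun j => (extChartAt (𝓡 (n j)) (x j)).source := by
  ext y
  simp only [extChartAt_source, Set.mem_pi, Set.mem_univ, true_imp_iff]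
  exact ⟨fun h j => h j (Set.mem_univ j), fun h j _ => h j⟩

lemma extChartAt_prodModel_target (x : ∀ j, M j) :
    (extChartAt (prodModel n) x).target =
      Set.univ.pi fun j => (extChartAt (𝓡 (n j)) (x j)).target := by
  ext y
  simp only [extChartAt_target, Set.mem_pi, Set.mem_univ, true_imp_iff,
    ModelWithCorners.range_eq_univ, Set.inter_univ, Set.mem_preimage]
  exact ⟨fun h j => h j (Set.mem_univ j), fun h j _ => h j⟩

lemma isFiniteMeasure_chartVolume {j : Fin k} (hf : ContMDiff (𝓡 (n j)) 𝓘(ℝ, V j) ∞ (f j))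
    (x : M j) : IsFiniteMeasure (chartVolume (𝓡 (n j)) (f j) x) := by
  have := isFiniteMeasure_inducedVolume hf
  exact isFiniteMeasure_of_le (inducedVolume (𝓡 (n j)) (f j))
    (le_iSup (chartVolume (𝓡 (n j)) (f j)) x)

lemma chartVolume_productMap (hf : ∀ j, ContMDiff (𝓡 (n j)) 𝓘(ℝ, V j) ∞ (f j))
    (x : ∀ j, M j) : chartVolume (prodModel n) (productMap c f) x =
      Measure.pi fun j => ‖c j‖₊ ^ n j • chartVolume (𝓡 (n j)) (f j) (x j) := by
  have hfin (j) := isFiniteMeasure_chartVolume (hf j) (x j)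
  refine (Measure.pi_eq fun A hA => ?_).symm
  set b := fun j => Module.finBasis ℝ (EuclideanSpace ℝ (Fin (n j))) with hb
  set s := fun j => (extChartAt (𝓡 (n j)) (x j)).symm ⁻¹' A j ∩
    (extChartAt (𝓡 (n j)) (x j)).target
  have hs (j) : MeasurableSet (s j) := measurableSet_symm_preimage (x j) (hA j)
  have hset : (extChartAt (prodModel n) x).symm ⁻¹' (Set.univ.pi A) ∩
      (extChartAt (prodModel n) x).target = Set.univ.pi s := by
    rw [extChartAt_prodModel_target, Set.pi_inter_distrib]
    rfl
  rw [chartVolume_apply (Pi.basis b) _ _ (MeasurableSet.univ_pi hA), hset, addHaar_pi_basis]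
  have h1 : ∫⁻ y in Set.univ.pi s, ENNReal.ofReal (gramDensity (Pi.basis b)
      (fderiv ℝ (localRep (prodModel n) (productMap c f) x) y))
        ∂Measure.pi (fun j => (b j).addHaar) =
      ∫⁻ y in Set.univ.pi s, ∏ j, ENNReal.ofReal (|c j| ^ n j *
        gramDensity (b j) (fderiv ℝ (localRep (𝓡 (n j)) (f j) (x j)) (y j)))
        ∂Measure.pi (fun j => (b j).addHaar) := by
    refine setLIntegral_congr_fun (MeasurableSet.univ_pi hs) fun y hy => ?_
    rw [localRep_productMap, fderiv_prodRep fun j =>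
      (contDiffAt_localRep (hf j) (hy j (Set.mem_univ j)).2).differentiableAt (by simp),
      gramDensity_prodRepL, ENNReal.ofReal_prod_of_nonneg]
    · simp
    · exact fun j _ => mul_nonneg (by positivity) (gramDensity_nonneg _ _)
  have hmeas (j) : AEMeasurable (fun y => ENNReal.ofReal (|c j| ^ n j *
        gramDensity (b j) (fderiv ℝ (localRep (𝓡 (n j)) (f j) (x j)) y)))
        ((b j).addHaar.restrict (s j)) :=
    ENNReal.measurable_ofReal.comp_aemeasurable
      (((continuousOn_gramDensity_localRep (b j) (hf j) (x j)).mono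
        Set.inter_subset_right).aemeasurable (hs j) |>.const_mul _)
  rw [h1, Measure.restrict_pi_pi, lintegral_fin_prod hmeas]
  refine Finset.prod_congr rfl fun j _ => ?_
  rw [Measure.coe_nnreal_smul_apply, chartVolume_apply (b j) _ _ (hA j),
    ← lintegral_const_mul' _ _ ENNReal.coe_ne_top]
  refine lintegral_congr fun y => ?_
  rw [ENNReal.ofReal_mul (by positivity)]
  congr 1
  rw [ENNReal.ofReal_pow (abs_nonneg _), ENNReal.coe_pow, ← Real.norm_eq_abs, ofReal_norm]
  rfl

lemma inducedVolume_productMap (hf : ∀ j, ContMDiff (𝓡 (n j)) 𝓘(ℝ, V j) ∞ (f j)) :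
    inducedVolume (prodModel n) (productMap c f) =
      Measure.pi fun j => ‖c j‖₊ ^ n j • inducedVolume (𝓡 (n j)) (f j) := by
  have hfin (j) := isFiniteMeasure_inducedVolume (hf j)
  refine iSup_eq_of_eq_restrict (fun x => isOpen_extChartAt_source (I := prodModel n) x)
    (fun x => mem_extChartAt_source x) fun x => ?_
  rw [chartVolume_productMap hf, extChartAt_prodModel_source, Measure.restrict_pi_pi]
  congr 1
  ext1 j
  rw [← inducedVolume_restrict (hf j), Measure.restrict_smul]

end ProductVolume

section FrameMap

variable {E : Type*} [NormedAddCommGroup E] [NormedSpace ℝ E] [FiniteDimensional ℝ E]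
  {V : Type*} [NormedAddCommGroup V] [InnerProductSpace ℝ V] [FiniteDimensional ℝ V]

lemma IsReproducing.eq_zero_of_frame {W ι : Type*} [Fintype ι] [NormedAddCommGroup W]
    [NormedSpace ℝ W] {D : E →L[ℝ] V} {e : ι → E}
    (he : IsReproducing D e) {B : E →L[ℝ] E →L[ℝ] W} (hB : ∀ i j, B (e i) (e j) = 0) (u v : E) :
    B u v = 0 := by
  rw [← he u, ← he v]
  simp [hB]

/-- The linear map `(u, t) ↦ D u + t q`, whose range is spanned by the range of `D` and `q`. -/
def frameMap (D : E →L[ℝ] V) (q : V) : E × ℝ →L[ℝ] V :=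
  D.comp (ContinuousLinearMap.fst ℝ E ℝ) +
    ContinuousLinearMap.smulRightL ℝ (E × ℝ) V (ContinuousLinearMap.snd ℝ E ℝ) q

lemma frameMap_apply (D : E →L[ℝ] V) (q : V) (u : E × ℝ) : frameMap D q u = D u.1 + u.2 • q := by
  simp [frameMap]

lemma range_frameMap (D : E →L[ℝ] V) (q : V) :
    LinearMap.range (frameMap D q : E × ℝ →ₗ[ℝ] V) =
      LinearMap.range (D : E →ₗ[ℝ] V) ⊔ Submodule.span ℝ {q} := by
  ext v
  simp only [LinearMap.mem_range, ContinuousLinearMap.coe_coe, frameMap_apply, Submodule.mem_sup,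
    Submodule.mem_span_singleton, Prod.exists]
  constructor
  · rintro ⟨u, t, rfl⟩
    exact ⟨D u, ⟨u, rfl⟩, t • q, ⟨t, rfl⟩, rfl⟩
  · rintro ⟨_, ⟨u, rfl⟩, _, ⟨t, rfl⟩, rfl⟩
    exact ⟨u, t, rfl⟩

lemma injective_frameMap {D : E →L[ℝ] V} (hD : Function.Injective D) {q : V} (hq : ‖q‖ = 1)
    (hDq : ∀ u, inner ℝ (D u) q = (0 : ℝ)) : Function.Injective (frameMap D q) := by
  rw [injective_iff_map_eq_zero]
  rintro ⟨u, t⟩ h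
  rw [frameMap_apply] at h
  have ht : t = 0 := by
    have := congrArg (fun v => (inner ℝ v q : ℝ)) h
    simpa [inner_add_left, inner_smul_left, hDq, real_inner_self_eq_norm_sq, hq] using this
  subst ht
  have hu : u = 0 := (injective_iff_map_eq_zero D).1 hD u (by simpa using h)
  rw [hu]
  rfl

lemma finrank_range_frameMap {D : E →L[ℝ] V} (hD : Function.Injective D) {q : V} (hq : ‖q‖ = 1)
    (hDq : ∀ u, inner ℝ (D u) q = (0 : ℝ)) :
    Module.finrank ℝ (LinearMap.range (D : E →ₗ[ℝ] V) ⊔ Submodule.span ℝ {q} : Submodule ℝ V) =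
      Module.finrank ℝ E + 1 := by
  rw [← range_frameMap, LinearMap.finrank_range_of_inj (injective_frameMap hD hq hDq)]
  simp

/-- If `g` has vanishing second fundamental form, the space spanned by its tangent plane and
its position is locally constant. -/
lemma eventually_range_frameMap_eq {g : E → V} {y : E} {U : Set E} (hU : IsOpen U) (hy : y ∈ U)
    (hg : ∀ z ∈ U, ContDiffAt ℝ ∞ g z) (hs : ∀ z, ‖g z‖ = 1)
    (hinj : ∀ z ∈ U, Function.Injective (fderiv ℝ g z))
    (hB : ∀ z ∈ U, ∀ u v, sffAt g z u v = 0) :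
    ∀ᶠ z in 𝓝 y, LinearMap.range (fderiv ℝ g z : E →ₗ[ℝ] V) ⊔ Submodule.span ℝ {g z} =
      LinearMap.range (fderiv ℝ g y : E →ₗ[ℝ] V) ⊔ Submodule.span ℝ {g y} := by
  have hs' (z) : ∀ᶠ w in 𝓝 z, ‖g w‖ = 1 := Filter.Eventually.of_forall hs
  have hd (z) (hz : z ∈ U) : DifferentiableAt ℝ g z := (hg z hz).differentiableAt (by simp)
  have hd2 (z) (hz : z ∈ U) : DifferentiableAt ℝ (fderiv ℝ g) z :=
    ((hg z hz).fderiv_right (m := 1) two_le_infty).differentiableAt (by simp)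
  set Φ : E → (E × ℝ →L[ℝ] V) := fun z => frameMap (fderiv ℝ g z) (g z) with hΦ
  have hΦinj (z) (hz : z ∈ U) : Function.Injective (Φ z) :=
    injective_frameMap (hinj z hz) (hs z) (inner_fderiv_self_of_sphere (hd z hz) (hs' z))
  obtain ⟨L₀, hL₀⟩ := LinearMap.exists_leftInverse_of_injective (Φ y : E × ℝ →ₗ[ℝ] V)
    (LinearMap.ker_eq_bot.2 (hΦinj y hy))
  set L : V →L[ℝ] E × ℝ := LinearMap.toContinuousLinearMap L₀
  have hL (w) : L (Φ y w) = w := DFunLike.congr_fun hL₀ w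
  have hΦd (z) (hz : z ∈ U) : DifferentiableAt ℝ Φ z :=
    ((hd2 z hz).clm_comp (differentiableAt_const _)).add
      ((ContinuousLinearMap.smulRightL ℝ (E × ℝ) V
        (ContinuousLinearMap.snd ℝ E ℝ)).differentiableAt.comp z (hd z hz))
  have happ {F G : Type _} [NormedAddCommGroup F] [NormedSpace ℝ F] [NormedAddCommGroup G]
      [NormedSpace ℝ G] {Θ : E → F →L[ℝ] G} {z : E} (h : DifferentiableAt ℝ Θ z) (v : E) (w : F) :
      fderiv ℝ (fun z => Θ z w) z v = fderiv ℝ Θ z v w := by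
    rw [fderiv_clm_apply h (differentiableAt_const w)]
    simp
  have hΦ' (z) (hz : z ∈ U) (v : E) (w : E × ℝ) : fderiv ℝ Φ z v w =
      fderiv ℝ (fderiv ℝ g) z v w.1 + w.2 • fderiv ℝ g z v := by
    rw [← happ (hΦd z hz)]
    simp only [hΦ, frameMap_apply]
    rw [fderiv_fun_add ((hd2 z hz).clm_apply (differentiableAt_const _))
      ((hd z hz).fun_const_smul _),
      add_apply, happ (hd2 z hz), fderiv_fun_const_smul (hd z hz)]
    rfl
  set A : E → (E × ℝ →L[ℝ] E × ℝ) := fun z => L.comp (Φ z) with hA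
  have hAd (z) (hz : z ∈ U) : DifferentiableAt ℝ A z :=
    (differentiableAt_const L).clm_comp (hΦd z hz)
  have hAy : A y = 1 := by
    refine ContinuousLinearMap.ext fun w => ?_
    exact hL w
  have hunit : ∀ᶠ z in 𝓝 y, IsUnit (A z) :=
    (hAd y hy).continuousAt.eventually (Units.isOpen.mem_nhds (by rw [hAy]; exact isUnit_one))
  set Ψ : E → (E × ℝ →L[ℝ] V) := fun z => (Φ z).comp (Ring.inverse (A z)) with hΨ
  have hΨA (z) (hz : IsUnit (A z)) : (Ψ z).comp (A z) = Φ z := by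
    have := Ring.inverse_mul_cancel _ hz
    refine ContinuousLinearMap.ext fun w => ?_
    exact congrArg (Φ z) (DFunLike.congr_fun this w)
  have hΨd (z) (hz : z ∈ U) (hz' : IsUnit (A z)) : DifferentiableAt ℝ Ψ z := by
    refine (hΦd z hz).clm_comp ?_
    obtain ⟨a, ha⟩ := hz'
    refine DifferentiableAt.comp (g := Ring.inverse) z ?_ (hAd z hz)
    rw [← ha]
    exact differentiableAt_inverse ⟨a, rfl⟩
  obtain ⟨r, hr, hball⟩ := Metric.eventually_nhds_iff_ball.1
    (Filter.Eventually.and (hU.mem_nhds hy) hunit)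
  have hΨ' : Set.EqOn (fderiv ℝ Ψ) 0 (Metric.ball y r) := by
    intro z hz
    obtain ⟨hzU, hzA⟩ := hball z hz
    ext1 v
    have h1 (w) : (fun z => Ψ z (A z w)) =ᶠ[𝓝 z] fun z => Φ z w := by
      filter_upwards [Metric.isOpen_ball.mem_nhds hz] with z' hz'
      exact DFunLike.congr_fun (hΨA z' (hball z' hz').2) w
    have h2 (w) : fderiv ℝ Ψ z v (A z w) + Ψ z (L (fderiv ℝ Φ z v w)) = fderiv ℝ Φ z v w := by
      have hΦw : DifferentiableAt ℝ (fun z => Φ z w) z :=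
        (hΦd z hzU).clm_apply (differentiableAt_const w)
      have hAw : fderiv ℝ (fun z => A z w) z v = L (fderiv ℝ Φ z v w) := by
        rw [← happ (hΦd z hzU)]
        exact DFunLike.congr_fun (L.hasFDerivAt.comp z hΦw.hasFDerivAt).fderiv v
      conv_rhs => rw [← happ (hΦd z hzU), ← (h1 w).fderiv_eq,
        fderiv_clm_apply (hΨd z hzU hzA) ((hAd z hzU).clm_apply (differentiableAt_const w))]
      simp only [add_apply, ContinuousLinearMap.comp_apply, hAw, ContinuousLinearMap.flip_apply]
      rw [add_comm]
    have h3 (w) : ∃ w', fderiv ℝ Φ z v w = Φ z w' := by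
      obtain ⟨p, hp⟩ := exists_fderiv_fderiv_eq ((hg z hzU).of_le two_le_infty) (hs' z) v w.1
      refine ⟨(p + w.2 • v, -inner ℝ (fderiv ℝ g z v) (fderiv ℝ g z w.1)), ?_⟩
      rw [hΦ' z hzU, hp, hB z hzU, hΦ, frameMap_apply]
      simp only [map_add, map_smul]
      module
    have h4 (w) : Ψ z (L (Φ z w)) = Φ z w := DFunLike.congr_fun (hΨA z hzA) w
    have h5 (w) : fderiv ℝ Ψ z v (A z w) = 0 := by
      have := h2 w
      obtain ⟨w', hw'⟩ := h3 w
      rwa [hw', h4, add_eq_right] at this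
    refine ContinuousLinearMap.ext fun w => ?_
    have h6 : A z (Ring.inverse (A z) w) = w :=
      DFunLike.congr_fun (Ring.mul_inverse_cancel _ hzA) w
    rw [← h6, h5]
    simp
  filter_upwards [Metric.ball_mem_nhds y hr] with z hz
  obtain ⟨hzU, hzA⟩ := hball z hz
  have hconst : Ψ z = Ψ y := Metric.isOpen_ball.is_const_of_fderiv_eq_zero
    (convex_ball y r).isPreconnected
    (fun w hw => (hΨd w (hball w hw).1 (hball w hw).2).differentiableWithinAt) hΨ' hz
    (Metric.mem_ball_self hr)
  have hΨy : Ψ y = Φ y := by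
    rw [hΨ]
    simp only [hAy, Ring.inverse_one]
    rfl
  have hle : LinearMap.range (fderiv ℝ g z : E →ₗ[ℝ] V) ⊔ Submodule.span ℝ {g z} ≤
      LinearMap.range (fderiv ℝ g y : E →ₗ[ℝ] V) ⊔ Submodule.span ℝ {g y} := by
    rw [← range_frameMap, ← range_frameMap]
    rintro _ ⟨w, rfl⟩
    refine ⟨A z w, ?_⟩
    change Φ y (A z w) = Φ z w
    rw [← hΨy, ← hconst, ← hΨA z hzA]
    rfl
  refine Submodule.eq_of_le_of_finrank_eq hle ?_
  rw [finrank_range_frameMap (hinj z hzU) (hs z) (inner_fderiv_self_of_sphere (hd z hzU) (hs' z)),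
    finrank_range_frameMap (hinj y hy) (hs y) (inner_fderiv_self_of_sphere (hd y hy) (hs' y))]

end FrameMap

section TotallyGeodesic

variable {E : Type*} [NormedAddCommGroup E] [NormedSpace ℝ E] [FiniteDimensional ℝ E]
  {H : Type*} [TopologicalSpace H] {I : ModelWithCorners ℝ E H} [I.Boundaryless]
  {M : Type*} [TopologicalSpace M] [ChartedSpace H M] [IsManifold I ∞ M]
  {V : Type*} [NormedAddCommGroup V] [InnerProductSpace ℝ V] [FiniteDimensional ℝ V]
  {f : M → V}

lemma sffAt_eq_zero (hf : IsMinimalInSphere I f) (hS : ∀ x, sqNormSFF I f x = 0) (x : M) {y : E}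
    (hy : y ∈ (extChartAt I x).target) (u v : E) : sffAt (localRep I f x) y u v = 0 := by
  set x' := (extChartAt I x).symm y
  have hx' : x' ∈ (extChartAt I x).source := (extChartAt I x).map_target hy
  obtain ⟨h1, h2, -⟩ := overlap_of_mem_source (I := I) hx'
  have h3 : IsReproducing (dAt I f x') (orthonormalFrame I f x') :=
    isReproducing_orthonormalFrame (by rw [← mfderiv_eq_dAt hf.contMDiff]; exact hf.immersion x')
  rw [dAt_eq_comp hf.contMDiff hx'] at h3
  have h4 := h3.comp (bijective_fderiv_transition h1 h2).2
  have h5 := sqNormSFF_eq hf.contMDiff hf.immersion hx' h4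
  rw [hS, (extChartAt I x).right_inv hy] at h5
  refine h4.eq_zero_of_frame (fun i j => ?_) u v
  have h6 := (Finset.sum_eq_zero_iff_of_nonneg
    (fun i _ => Finset.sum_nonneg fun j _ => sq_nonneg _)).1 h5.symm i (Finset.mem_univ i)
  have h7 := (Finset.sum_eq_zero_iff_of_nonneg (fun j _ => sq_nonneg _)).1 h6 j
    (Finset.mem_univ j)
  simpa using h7

/-- The span of the tangent plane and of the position. -/
def linearHull (I : ModelWithCorners ℝ E H) (f : M → V) (x : M) : Submodule ℝ V :=
  tangentPlane I f x ⊔ Submodule.span ℝ {f x}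

lemma linearHull_eq (hf : ContMDiff I 𝓘(ℝ, V) ∞ f) {x x' : M}
    (hx' : x' ∈ (extChartAt I x).source) : linearHull I f x' =
      LinearMap.range (fderiv ℝ (localRep I f x) (extChartAt I x x') : E →ₗ[ℝ] V) ⊔
        Submodule.span ℝ {localRep I f x (extChartAt I x x')} := by
  obtain ⟨h1, h2, -⟩ := overlap_of_mem_source (I := I) hx'
  rw [linearHull, tangentPlane, dAt_eq_comp hf hx', localRep_extChartAt hx']
  congr 1
  exact LinearMap.range_comp_of_range_eq_top _
    (LinearMap.range_eq_top.2 (bijective_fderiv_transition h1 h2).2)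

lemma inner_dAt (hf : IsMinimalInSphere I f) (x : M) (u : E) :
    inner ℝ (dAt I f x u) (f x) = (0 : ℝ) := by
  have := inner_fderiv_self_of_sphere ((contDiffAt_localRep hf.contMDiff
    (mem_extChartAt_target x)).differentiableAt (by simp)) (Filter.Eventually.of_forall
    (norm_localRep hf.mem_sphere x)) u
  rwa [localRep_extChartAt (mem_extChartAt_source x)] at this

lemma finrank_linearHull (hf : IsMinimalInSphere I f) (x : M) :
    Module.finrank ℝ (linearHull I f x) = Module.finrank ℝ E + 1 :=
  finrank_range_frameMap (by rw [← mfderiv_eq_dAt hf.contMDiff]; exact hf.immersion x)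
    (mem_sphere_zero_iff_norm.1 (hf.mem_sphere x)) (inner_dAt hf x)

lemma linearHull_const [PreconnectedSpace M] (hf : IsMinimalInSphere I f)
    (hS : ∀ x, sqNormSFF I f x = 0) (x x' : M) : linearHull I f x = linearHull I f x' := by
  refine IsLocallyConstant.apply_eq_of_preconnectedSpace
    ((IsLocallyConstant.iff_eventually_eq _).2 fun x => ?_) x x'
  have h := eventually_range_frameMap_eq (g := localRep I f x) (isOpen_extChartAt_target x)
    (mem_extChartAt_target x) (fun z hz => contDiffAt_localRep hf.contMDiff hz)
    (norm_localRep hf.mem_sphere x)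
    (fun z hz => injective_fderiv_localRep hf.contMDiff hf.immersion hz)
    (fun z hz => sffAt_eq_zero hf hS x hz)
  filter_upwards [(continuousAt_extChartAt x).eventually h, extChartAt_source_mem_nhds (I := I) x]
    with x' h1 h2
  rw [linearHull_eq hf.contMDiff h2, linearHull_eq hf.contMDiff (mem_extChartAt_source x), h1]

lemma mem_linearHull (x : M) : f x ∈ linearHull I f x :=
  Submodule.mem_sup_right (Submodule.mem_span_singleton_self _)

lemma fderiv_mem_of_eventually_mem {g : E → V} {y : E} {W : Submodule ℝ V} {q : V}
    (h : ∀ᶠ z in 𝓝 y, g z - q ∈ W) (u : E) : fderiv ℝ g y u ∈ W := by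
  by_cases hg : DifferentiableAt ℝ g y
  · have h1 : (fun z => Wᗮ.starProjection (g z - q)) =ᶠ[𝓝 y] fun _ => 0 := by
      filter_upwards [h] with z hz
      rw [Submodule.starProjection_orthogonal_val, Submodule.starProjection_eq_self_iff.2 hz,
        sub_self]
    have h2 : HasFDerivAt (fun z => Wᗮ.starProjection (g z - q))
        (Wᗮ.starProjection.comp (fderiv ℝ g y)) y :=
      Wᗮ.starProjection.hasFDerivAt.comp y (hg.hasFDerivAt.sub_const q)
    have h3 := DFunLike.congr_fun (h2.fderiv.symm.trans h1.fderiv_eq) u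
    simp only [ContinuousLinearMap.comp_apply, fderiv_fun_const, Pi.zero_apply,
      zero_apply] at h3
    rw [Submodule.starProjection_orthogonal_val, sub_eq_zero] at h3
    exact Submodule.starProjection_eq_self_iff.1 h3.symm
  · simp [fderiv_zero_of_not_differentiableAt hg]

lemma fderiv_fderiv_mem_of_eventually_mem {g : E → V} {y : E} {W : Submodule ℝ V} {q : V}
    (hg : ContDiffAt ℝ 2 g y) (h : ∀ᶠ z in 𝓝 y, g z - q ∈ W) (u v : E) :
    fderiv ℝ (fderiv ℝ g) y u v ∈ W := by
  have h1 : ∀ᶠ z in 𝓝 y, fderiv ℝ g z v - 0 ∈ W := by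
    filter_upwards [h.eventually_nhds] with z hz
    rw [sub_zero]
    exact fderiv_mem_of_eventually_mem hz v
  have h2 := fderiv_mem_of_eventually_mem h1 u
  rw [fderiv_clm_apply ((hg.fderiv_right (m := 1) (by norm_num)).differentiableAt (by simp))
    (differentiableAt_const v)] at h2
  simpa using h2

lemma linearHull_le {W : Submodule ℝ V} (hW : ∀ x, f x ∈ W) (x : M) :
    linearHull I f x ≤ W := by
  refine sup_le ?_ (by simpa using hW x)
  rintro _ ⟨u, rfl⟩
  exact fderiv_mem_of_eventually_mem (q := 0)
    (Filter.Eventually.of_forall fun z => by rw [sub_zero]; exact hW _) u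

lemma sqNormSFF_eq_zero_of_mem (hf : IsMinimalInSphere I f) {W : Submodule ℝ V}
    (hW : ∀ x, f x ∈ W) (hWd : Module.finrank ℝ W ≤ Module.finrank ℝ E + 1) (x : M) :
    sqNormSFF I f x = 0 := by
  have hWx : linearHull I f x = W :=
    Submodule.eq_of_le_of_finrank_le (linearHull_le hW x) (by rwa [finrank_linearHull hf])
  have h (u v : E) : secondFundamentalForm I f x u v = 0 := by
    have h1 : fderiv ℝ (fderiv ℝ (localRep I f x)) (extChartAt I x x) u v ∈ linearHull I f x := by
      rw [hWx]
      exact fderiv_fderiv_mem_of_eventually_mem (q := 0)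
        ((contDiffAt_localRep hf.contMDiff (mem_extChartAt_target x)).of_le two_le_infty)
        (Filter.Eventually.of_forall fun z => by rw [sub_zero]; exact hW _) u v
    unfold secondFundamentalForm normalSpace
    rw [Submodule.starProjection_orthogonal_val, sub_eq_zero, eq_comm]
    exact Submodule.starProjection_eq_self_iff.2 h1
  simp [sqNormSFF, h]

lemma mem_of_forall_sub_mem (hf : IsMinimalInSphere I f) (hE : Module.finrank ℝ E ≠ 0)
    {W : Submodule ℝ V} (hW : ∀ x x', f x - f x' ∈ W) (x : M) : f x ∈ W := by
  set g := localRep I f x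
  set y := extChartAt I x x
  have hg : ContDiffAt ℝ 2 g y :=
    (contDiffAt_localRep hf.contMDiff (mem_extChartAt_target x)).of_le two_le_infty
  have hgW : ∀ᶠ z in 𝓝 y, g z - f x ∈ W := Filter.Eventually.of_forall fun z => hW _ _
  have h0 := hf.sum_secondFundamentalForm hE x
  simp only [secondFundamentalForm_eq_sffAt] at h0
  choose w hw using fun i => exists_fderiv_fderiv_eq hg
    (Filter.Eventually.of_forall (norm_localRep hf.mem_sphere x)) (orthonormalFrame I f x i)
    (orthonormalFrame I f x i)
  have h1 := sum_norm_sq_dAt_orthonormalFrame (I := I) (f := f) (x := x)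
    (by rw [← mfderiv_eq_dAt hf.contMDiff]; exact hf.immersion x)
  have h2 : (Module.finrank ℝ E : ℝ) • f x = ∑ i, (fderiv ℝ g y (w i) -
      fderiv ℝ (fderiv ℝ g) y (orthonormalFrame I f x i) (orthonormalFrame I f x i)) := by
    simp only [hw]
    simp only [real_inner_self_eq_norm_sq, Finset.sum_sub_distrib, Finset.sum_add_distrib]
    have hgy : g y = f x := localRep_extChartAt (mem_extChartAt_source x)
    rw [h0, ← Finset.sum_smul, hgy, ← h1, add_zero, sub_sub_cancel]
    rfl
  have h3 : (Module.finrank ℝ E : ℝ) • f x ∈ W := by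
    rw [h2]
    exact Submodule.sum_mem _ fun i _ => Submodule.sub_mem _ (fderiv_mem_of_eventually_mem hgW _)
      (fderiv_fderiv_mem_of_eventually_mem hg hgW _ _)
  exact (Submodule.smul_mem_iff _ (by exact_mod_cast hE)).1 h3

end TotallyGeodesic

section Covering

/-- A simply connected chart of the base of a covering has a section through a given point. -/
lemma exists_section_of_isCoveringMap {X Y A : Type*} [TopologicalSpace X] [TopologicalSpace Y]
    [TopologicalSpace A] [SimplyConnectedSpace A] [LocallyPathConnectedSpace A]
    {p : X → Y} (hp : IsCoveringMap p) (e : OpenPartialHomeomorph Y A)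
    (ht : e.target = Set.univ) {x₀ : X} (hx : p x₀ ∈ e.source) :
    ∃ s : Y → X, ContinuousOn s e.source ∧ s (p x₀) = x₀ ∧ ∀ y ∈ e.source, p (s y) = y := by
  have hc : Continuous e.symm := by
    have := e.continuousOn_symm
    rwa [ht, continuousOn_univ] at this
  obtain ⟨F, ⟨hF0, hF⟩, -⟩ := hp.existsUnique_continuousMap_lifts ⟨e.symm, hc⟩ (e (p x₀)) x₀
    (e.left_inv hx).symm
  refine ⟨fun y => F (e y), F.continuous.comp_continuousOn e.continuousOn, hF0, fun y hy => ?_⟩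
  exact (congrFun hF (e y)).trans (e.left_inv hy)

/-- A covering map onto a union of two simply connected charts with connected intersection is
injective. -/
lemma injective_of_isCoveringMap {X Y A₁ A₂ : Type*} [TopologicalSpace X] [TopologicalSpace Y]
    [TopologicalSpace A₁] [TopologicalSpace A₂] [PreconnectedSpace X] [SimplyConnectedSpace A₁]
    [LocallyPathConnectedSpace A₁] [SimplyConnectedSpace A₂] [LocallyPathConnectedSpace A₂]
    {p : X → Y} (hp : IsCoveringMap p) (e₁ : OpenPartialHomeomorph Y A₁)
    (e₂ : OpenPartialHomeomorph Y A₂) (ht₁ : e₁.target = Set.univ) (ht₂ : e₂.target = Set.univ)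
    (hs : ∀ y, y ∈ e₁.source ∨ y ∈ e₂.source) (hconn : IsPreconnected (e₁.source ∩ e₂.source))
    {x₀ : X} (hx₀ : p x₀ ∈ e₁.source ∩ e₂.source) : Function.Injective p := by
  classical
  obtain ⟨s₁, hc₁, h₁, hs₁⟩ := exists_section_of_isCoveringMap hp e₁ ht₁ hx₀.1
  obtain ⟨s₂, hc₂, h₂, hs₂⟩ := exists_section_of_isCoveringMap hp e₂ ht₂ hx₀.2
  have hagree : (e₁.source ∩ e₂.source).EqOn s₁ s₂ :=
    hp.eqOn_of_comp_eqOn hconn (hc₁.mono Set.inter_subset_left) (hc₂.mono Set.inter_subset_right)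
      (fun y hy => (hs₁ y hy.1).trans (hs₂ y hy.2).symm) hx₀ (h₁.trans h₂.symm)
  set s : Y → X := fun y => if y ∈ e₁.source then s₁ y else s₂ y with hsdef
  have hse₁ : e₁.source.EqOn s s₁ := fun y hy => if_pos hy
  have hse₂ : e₂.source.EqOn s s₂ := fun y hy => by
    by_cases hy₁ : y ∈ e₁.source
    · exact (if_pos hy₁).trans (hagree ⟨hy₁, hy⟩)
    · exact if_neg hy₁
  have hsc : Continuous s := continuous_iff_continuousAt.2 fun y => by
    rcases hs y with hy | hy
    · exact (hc₁.congr hse₁).continuousAt (e₁.open_source.mem_nhds hy)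
    · exact (hc₂.congr hse₂).continuousAt (e₂.open_source.mem_nhds hy)
  have hps (y) : p (s y) = y := by
    rcases hs y with hy | hy
    · rw [hse₁ hy, hs₁ y hy]
    · rw [hse₂ hy, hs₂ y hy]
  have hsp : s ∘ p = id := hp.eq_of_comp_eq (hsc.comp hp.continuous) continuous_id
    (funext fun x => hps (p x)) x₀ ((hse₁ hx₀.1).trans h₁)
  exact Function.LeftInverse.injective (congrFun hsp)

variable {F : Type*} [NormedAddCommGroup F] [InnerProductSpace ℝ F] [FiniteDimensional ℝ F]

/-- A covering of a sphere of dimension at least two by a connected space is injective. -/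
lemma injective_of_isCoveringMap_sphere {X : Type*} [TopologicalSpace X] [ConnectedSpace X]
    (hF : 3 ≤ Module.finrank ℝ F) {p : X → Metric.sphere (0 : F) 1} (hp : IsCoveringMap p) :
    Function.Injective p := by
  obtain ⟨x₀⟩ := (inferInstance : Nonempty X)
  set q : F := (p x₀ : F)
  have hq : ‖q‖ = 1 := by simp [q]
  obtain ⟨v₀, hv₀, hv₀q⟩ : ∃ v : F, v ≠ 0 ∧ inner ℝ v q = (0 : ℝ) := by
    have hfin : Module.finrank ℝ (ℝ ∙ q)ᗮ ≠ 0 := by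
      have h1 := (ℝ ∙ q).finrank_add_finrank_orthogonal
      have h2 := finrank_span_le_card (R := ℝ) ({q} : Set F)
      simp at h2
      omega
    have : Nontrivial (ℝ ∙ q)ᗮ := Module.nontrivial_of_finrank_pos (Nat.pos_of_ne_zero hfin)
    obtain ⟨v, hv⟩ := exists_ne (0 : (ℝ ∙ q)ᗮ)
    exact ⟨v, by simpa using hv, Submodule.mem_orthogonal_singleton_iff_inner_left.1 v.2⟩
  obtain ⟨v, hv, hvq⟩ : ∃ v : F, ‖v‖ = 1 ∧ inner ℝ v q = (0 : ℝ) :=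
    ⟨‖v₀‖⁻¹ • v₀, by simp [norm_smul, hv₀], by simp [inner_smul_left, hv₀q]⟩
  have hv' : ‖-v‖ = 1 := by rwa [norm_neg]
  have hvne : -v ≠ v := fun h => by
    have := congrArg (fun w => (inner ℝ v w : ℝ)) h
    simp only [inner_neg_right, real_inner_self_eq_norm_sq, hv] at this
    norm_num at this
  have hne {w : F} (hw : ‖w‖ = 1) (hwq : inner ℝ w q = (0 : ℝ)) : q ≠ w := by
    rintro rfl
    rw [real_inner_self_eq_norm_sq, hw] at hwq
    norm_num at hwq
  have hconn : IsPreconnected ((stereographic hv).source ∩ (stereographic hv').source) := by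
    have hfin : 1 < Module.rank ℝ (ℝ ∙ v)ᗮ := by
      have h1 := (ℝ ∙ v).finrank_add_finrank_orthogonal
      have h2 := finrank_span_le_card (R := ℝ) ({v} : Set F)
      simp at h2
      rw [← Module.finrank_eq_rank]
      exact_mod_cast (by omega : 1 < Module.finrank ℝ (ℝ ∙ v)ᗮ)
    have h3 := (isConnected_compl_singleton_of_one_lt_rank hfin 0).isPreconnected.image
      (stereographic hv).symm (isOpenEmbedding_stereographic_symm hv).continuous.continuousOn
    convert h3 using 1
    ext y
    have h4 : stereographic hv ⟨-v, by simp [hv]⟩ = 0 :=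
      stereographic_apply_neg ⟨v, by simp [hv]⟩
    simp only [stereographic_source, Set.mem_inter_iff, Set.mem_compl_iff, Set.mem_singleton_iff,
      Set.mem_image]
    constructor
    · rintro ⟨hy1, hy2⟩
      refine ⟨stereographic hv y, fun h => hy2 ?_, (stereographic hv).left_inv (by simpa using hy1)⟩
      refine (stereographic hv).injOn (by simpa using hy1) ?_ (h.trans h4.symm)
      simp only [stereographic_source, Set.mem_compl_iff, Set.mem_singleton_iff, Subtype.mk.injEq]
      exact hvne
    · rintro ⟨w, hw, rfl⟩
      refine ⟨?_, fun h => hw ?_⟩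
      · have := (stereographic hv).map_target (x := w) (by simp)
        simpa using this
      · have := (stereographic hv).right_inv (x := w) (by simp)
        rw [← this, h, h4]
  refine injective_of_isCoveringMap hp (stereographic hv) (stereographic hv') rfl rfl
    (fun y => ?_) hconn (x₀ := x₀) ⟨?_, ?_⟩
  · simp only [stereographic_source, Set.mem_compl_iff, Set.mem_singleton_iff, Subtype.ext_iff]
    by_contra! h
    exact hvne (h.2.symm.trans h.1)
  · simpa [Subtype.ext_iff] using hne hv hvq
  · simpa [Subtype.ext_iff] using hne hv' (by simpa using hvq)

end Covering

section InverseFunction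

variable {E E' : Type*} [NormedAddCommGroup E] [NormedSpace ℝ E] [CompleteSpace E]
  [NormedAddCommGroup E'] [NormedSpace ℝ E'] [CompleteSpace E']
  {H H' : Type*} [TopologicalSpace H] [TopologicalSpace H']
  {I : ModelWithCorners ℝ E H} [I.Boundaryless] {J : ModelWithCorners ℝ E' H'} [J.Boundaryless]
  {M N : Type*} [TopologicalSpace M] [ChartedSpace H M] [IsManifold I ∞ M]
  [TopologicalSpace N] [ChartedSpace H' N] [IsManifold J ∞ N]

/-- The inverse function theorem for smooth maps between manifolds without boundary. -/
theorem isLocalDiffeomorph_of_bijective_mfderiv {F : M → N} (hF : ContMDiff I J ∞ F)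
    (hb : ∀ x, Function.Bijective (mfderiv I J F x)) : IsLocalDiffeomorph I J ∞ F := by
  intro x
  set e : OpenPartialHomeomorph M E := (chartAt H x).transHomeomorph I.toHomeomorph
  set e' : OpenPartialHomeomorph N E' := (chartAt H' (F x)).transHomeomorph J.toHomeomorph
  set G : E → E' := e' ∘ F ∘ e.symm
  have hx : x ∈ e.source := mem_chart_source H x
  have hFx : F x ∈ e'.source := mem_chart_source H' (F x)
  have hes (z) (hz : z ∈ e.target) : ContMDiffAt 𝓘(ℝ, E) I ∞ e.symm z := by
    refine (contMDiffOn_extChartAt_symm x).contMDiffAt ((isOpen_extChartAt_target x).mem_nhds ?_)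
    rw [extChartAt_target, I.range_eq_univ, Set.inter_univ]
    exact hz
  have he's (q) (hq : q ∈ e'.source) : ContMDiffAt J 𝓘(ℝ, E') ∞ e' q := by
    refine contMDiffAt_extChartAt' hq
  set U : Set E := e.target ∩ (F ∘ e.symm) ⁻¹' e'.source
  have hUo : IsOpen U :=
    (hF.continuous.comp_continuousOn e.continuousOn_symm).isOpen_inter_preimage e.open_target
      e'.open_source
  have hxU : e x ∈ U := ⟨e.map_source hx, by simpa [e.left_inv hx] using hFx⟩
  have hGU (z) (hz : z ∈ U) : ContMDiffAt 𝓘(ℝ, E) 𝓘(ℝ, E') ∞ G z :=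
    (he's _ hz.2).comp z ((hF _).comp z (hes z hz.1))
  have hGd : Function.Bijective (fderiv ℝ G (e x)) := by
    have h : (fderiv ℝ G (e x) : E → E') = mfderiv I J F x := by
      rw [((hF x).mdifferentiableAt (by simp)).mfderiv, I.range_eq_univ, fderivWithin_univ]
      rfl
    rw [h]
    exact hb x
  set A : E ≃L[ℝ] E' := ContinuousLinearEquiv.ofBijective (fderiv ℝ G (e x))
    (LinearMap.ker_eq_bot.2 hGd.1) (LinearMap.range_eq_top.2 hGd.2)
  have hGx : ContDiffAt ℝ ∞ G (e x) := (hGU _ hxU).contDiffAt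
  have hA : HasFDerivAt G (A : E →L[ℝ] E') (e x) :=
    (hGx.differentiableAt (by simp)).hasFDerivAt
  obtain ⟨U', hU', hU'o, hxU'⟩ : ∃ U' ⊆ U, IsOpen U' ∧ e x ∈ U' ∧ ∀ z ∈ U',
      ∃ B : E ≃L[ℝ] E', HasFDerivAt G (B : E →L[ℝ] E') z := by
    have h1 : ContinuousAt (fderiv ℝ G) (e x) :=
      (hGx.fderiv_right (m := 0) (by simp)).continuousAt
    have h2 := h1.eventually (A.nhds)
    obtain ⟨t, ht, hto, hxt⟩ := mem_nhds_iff.1 (Filter.inter_mem (hUo.mem_nhds hxU) h2)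
    refine ⟨t, fun z hz => (ht hz).1, hto, hxt, fun z hz => ?_⟩
    obtain ⟨B, hB⟩ := (ht hz).2
    refine ⟨B, ?_⟩
    rw [hB]
    exact (((hGU _ (ht hz).1).contDiffAt).differentiableAt (by simp)).hasFDerivAt
  set g : OpenPartialHomeomorph E E' :=
    (hGx.toOpenPartialHomeomorph G hA (by simp)).restrOpen U' hU'o
  have hgU (z) (hz : z ∈ g.source) : z ∈ U' := hz.2
  have hgsymm (w) (hw : w ∈ g.target) : ContDiffAt ℝ ∞ g.symm w := by
    have hz := hgU _ (g.map_target hw)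
    obtain ⟨B, hB⟩ := hxU'.2 _ hz
    exact g.contDiffAt_symm hw hB (hGU _ (hU' hz)).contDiffAt
  set Φ : OpenPartialHomeomorph M N := (e.trans g).trans e'.symm
  have hΦF : Set.EqOn F Φ Φ.source := fun z hz => by
    have hz1 : z ∈ e.source := hz.1.1
    have hz2 : e z ∈ U := hU' (hgU _ hz.1.2)
    change F z = e'.symm (e' (F (e.symm (e z))))
    rw [e'.left_inv (x := F (e.symm (e z))) hz2.2, e.left_inv hz1]
  refine ⟨⟨Φ.toPartialEquiv, Φ.open_source, Φ.open_target, hF.contMDiffOn.congr fun z hz => ?_,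
    fun q hq => ContMDiffAt.contMDiffWithinAt ?_⟩, ?_, hΦF⟩
  · exact (hΦF hz).symm
  · have hq1 : q ∈ e'.source := hq.1
    have hq2 : e' q ∈ g.target := hq.2.1
    have hq3 : g.symm (e' q) ∈ e.target := hq.2.2
    have hq4 : ContMDiffAt J 𝓘(ℝ, E) ∞ (g.symm ∘ e') q :=
      (hgsymm _ hq2).contMDiffAt.comp q (he's q hq1)
    exact ContMDiffAt.comp (g := e.symm) (f := g.symm ∘ e') q (hes _ hq3) hq4
  · refine ⟨⟨hx, ⟨?_, hxU'.1⟩⟩, ?_⟩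
    · exact hGx.mem_toOpenPartialHomeomorph_source hA (by simp)
    · exact e'.map_source hxU.2

end InverseFunction

section GreatSphere

variable {n : ℕ} {M : Type*} [TopologicalSpace M] [ChartedSpace (EuclideanSpace ℝ (Fin n)) M]
  [IsManifold (𝓡 n) ∞ M]
  {V : Type*} [NormedAddCommGroup V] [InnerProductSpace ℝ V] [FiniteDimensional ℝ V]
  {f : M → V}

lemma exists_isometry_range_eq {W : Submodule ℝ V} {m : ℕ} (hW : Module.finrank ℝ W = m) :
    ∃ A : EuclideanSpace ℝ (Fin m) →ₗᵢ[ℝ] V, ∀ v ∈ W, ∃ w, A w = v := by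
  subst hW
  refine ⟨W.subtypeₗᵢ.comp (stdOrthonormalBasis ℝ W).repr.symm.toLinearIsometry, fun v hv => ?_⟩
  exact ⟨(stdOrthonormalBasis ℝ W).repr ⟨v, hv⟩, by simp⟩

lemma contMDiff_coe_euclideanSphere : ContMDiff (𝓡 n) 𝓘(ℝ, EuclideanSpace ℝ (Fin (n + 1))) ∞
    (Subtype.val : Metric.sphere (0 : EuclideanSpace ℝ (Fin (n + 1))) 1 → _) :=
  haveI := Fact.mk (@finrank_euclideanSpace_fin ℝ _ (n + 1))
  contMDiff_coe_sphere

lemma contMDiff_codRestrict_euclideanSphere {h : M → EuclideanSpace ℝ (Fin (n + 1))}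
    (hh : ContMDiff (𝓡 n) 𝓘(ℝ, EuclideanSpace ℝ (Fin (n + 1))) ∞ h)
    (hs : ∀ x, h x ∈ Metric.sphere (0 : EuclideanSpace ℝ (Fin (n + 1))) 1) :
    ContMDiff (𝓡 n) (𝓡 n) ∞ (Set.codRestrict h _ hs) :=
  haveI := Fact.mk (@finrank_euclideanSpace_fin ℝ _ (n + 1))
  hh.codRestrict_sphere hs

/-- A totally geodesic immersion of a closed manifold into the unit sphere is a local
diffeomorphism onto a great sphere. -/
lemma exists_isLocalDiffeomorph_sphere [ConnectedSpace M]
    (hf : IsMinimalInSphere (𝓡 n) f) (hS : ∀ x, sqNormSFF (𝓡 n) f x = 0) :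
    ∃ (A : EuclideanSpace ℝ (Fin (n + 1)) →ₗᵢ[ℝ] V)
      (g : M → Metric.sphere (0 : EuclideanSpace ℝ (Fin (n + 1))) 1),
      IsLocalDiffeomorph (𝓡 n) (𝓡 n) ∞ g ∧ ∀ x, f x = A (g x) := by
  obtain ⟨x₀⟩ := (inferInstance : Nonempty M)
  obtain ⟨A, hA⟩ := exists_isometry_range_eq (W := linearHull (𝓡 n) f x₀) (m := n + 1)
    (by rw [finrank_linearHull hf]; simp)
  choose h hh using fun x => hA (f x) (by rw [linearHull_const hf hS x₀ x]; exact mem_linearHull x)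
  have hh' (x) : h x = A.toContinuousLinearMap.adjoint (f x) := by
    rw [← hh]
    refine ext_inner_left ℝ fun w => ?_
    rw [ContinuousLinearMap.adjoint_inner_right]
    exact (A.inner_map_map _ _).symm
  have hhsmooth : ContMDiff (𝓡 n) 𝓘(ℝ, EuclideanSpace ℝ (Fin (n + 1))) ∞ h := by
    rw [funext hh']
    exact (ContinuousLinearMap.contMDiff _).comp hf.contMDiff
  have hhs (x) : h x ∈ Metric.sphere (0 : EuclideanSpace ℝ (Fin (n + 1))) 1 := by
    have := hf.mem_sphere x
    rw [← hh] at this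
    simpa using this
  set g := Set.codRestrict h _ hhs
  have hg : ContMDiff (𝓡 n) (𝓡 n) ∞ g := contMDiff_codRestrict_euclideanSphere hhsmooth hhs
  refine ⟨A, g, isLocalDiffeomorph_of_bijective_mfderiv hg fun x => ?_, fun x => (hh x).symm⟩
  have hcomp : f = (A.toContinuousLinearMap ∘ Subtype.val) ∘ g :=
    funext fun x => (hh x).symm
  have hinj := hf.immersion x
  rw [hcomp, mfderiv_comp x (I' := 𝓡 n) (((ContinuousLinearMap.contMDiff _).comp
    contMDiff_coe_euclideanSphere).mdifferentiableAt (by simp))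
    (hg.mdifferentiableAt (by simp))] at hinj
  have hinj' : Function.Injective (mfderiv (𝓡 n) (𝓡 n) g x) :=
    Function.Injective.of_comp (f := mfderiv (𝓡 n) 𝓘(ℝ, V)
      (A.toContinuousLinearMap ∘ Subtype.val) (g x)) hinj
  have hbij (T : EuclideanSpace ℝ (Fin n) →L[ℝ] EuclideanSpace ℝ (Fin n))
      (hT : Function.Injective T) : Function.Bijective T :=
    ⟨hT, LinearMap.surjective_of_injective (f := (T : _ →ₗ[ℝ] EuclideanSpace ℝ (Fin n))) hT⟩
  exact hbij (mfderiv (𝓡 n) (𝓡 n) g x) hinj'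

lemma surjective_of_isLocalDiffeomorph_sphere [CompactSpace M] [Nonempty M] (hn : 0 < n)
    {g : M → Metric.sphere (0 : EuclideanSpace ℝ (Fin (n + 1))) 1}
    (hg : IsLocalDiffeomorph (𝓡 n) (𝓡 n) ∞ g) : Function.Surjective g := by
  have : PreconnectedSpace (Metric.sphere (0 : EuclideanSpace ℝ (Fin (n + 1))) 1) := by
    refine isPreconnected_iff_preconnectedSpace.1 (isPreconnected_sphere ?_ 0 1)
    rw [← Module.finrank_eq_rank, finrank_euclideanSpace_fin]
    exact_mod_cast (by omega : 1 < n + 1)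
  have hclopen : IsClopen (Set.range g) :=
    ⟨(isCompact_range hg.contMDiff.continuous).isClosed, hg.isOpen_range⟩
  exact Set.range_eq_univ.1 (hclopen.eq_univ (Set.range_nonempty g))

lemma injective_of_isLocalDiffeomorph_sphere [CompactSpace M] [T2Space M] [ConnectedSpace M]
    (hn : 2 ≤ n) {g : M → Metric.sphere (0 : EuclideanSpace ℝ (Fin (n + 1))) 1}
    (hg : IsLocalDiffeomorph (𝓡 n) (𝓡 n) ∞ g) : Function.Injective g :=
  injective_of_isCoveringMap_sphere (by simp; omega)
    (isLocalHomeomorph_iff_isCoveringMap.1 hg.isLocalHomeomorph)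

end GreatSphere

section ProductDiffeomorphism

variable {k : ℕ} {n : Fin k → ℕ} {M N : Fin k → Type*}
  [∀ j, TopologicalSpace (M j)] [∀ j, ChartedSpace (EuclideanSpace ℝ (Fin (n j))) (M j)]
  [∀ j, TopologicalSpace (N j)] [∀ j, ChartedSpace (EuclideanSpace ℝ (Fin (n j))) (N j)]

lemma contMDiff_piMap {g : ∀ j, M j → N j}
    (hg : ∀ j, ContMDiff (𝓡 (n j)) (𝓡 (n j)) ∞ (g j)) :
    ContMDiff (prodModel n) (prodModel n) ∞ (Pi.map g) := by
  intro x
  rw [contMDiffAt_iff]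
  refine ⟨(Continuous.piMap fun j => (hg j).continuous).continuousAt, ?_⟩
  rw [ModelWithCorners.range_eq_univ, contDiffWithinAt_univ, contDiffAt_pi]
  intro j
  have h := (contMDiffAt_iff.1 (hg j (x j))).2
  rw [ModelWithCorners.range_eq_univ, contDiffWithinAt_univ] at h
  exact ContDiffAt.comp (g := extChartAt (𝓡 (n j)) (g j (x j)) ∘ g j ∘
    (extChartAt (𝓡 (n j)) (x j)).symm) (f := fun y : ∀ i, EuclideanSpace ℝ (Fin (n i)) => y j)
    (extChartAt (prodModel n) x x) h (contDiff_pi.1 contDiff_id j).contDiffAt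

/-- The product of diffeomorphisms. -/
def piDiffeomorph (φ : ∀ j, Diffeomorph (𝓡 (n j)) (𝓡 (n j)) (M j) (N j) ∞) :
    Diffeomorph (prodModel n) (prodModel n) (∀ j, M j) (∀ j, N j) ∞ where
  toEquiv := Equiv.piCongrRight fun j => (φ j).toEquiv
  contMDiff_toFun := contMDiff_piMap fun j => (φ j).contMDiff
  contMDiff_invFun := contMDiff_piMap fun j => (φ j).symm.contMDiff

end ProductDiffeomorphism

section Congruence

variable {k : ℕ} {U V : Fin k → Type*}
  [∀ j, NormedAddCommGroup (U j)] [∀ j, InnerProductSpace ℝ (U j)]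
  [∀ j, NormedAddCommGroup (V j)] [∀ j, InnerProductSpace ℝ (V j)]

/-- The orthogonal sum of linear isometries. -/
def piLpIsometry (B : ∀ j, U j →ₗᵢ[ℝ] V j) : PiLp 2 U →ₗᵢ[ℝ] PiLp 2 V where
  toFun w := WithLp.toLp 2 fun j => B j (w j)
  map_add' v w := by ext j; simp
  map_smul' t w := by ext j; simp
  norm_map' w := by simp [PiLp.norm_eq_of_L2]

lemma productMap_eq_piLpIsometry {M N : Fin k → Type*} {c d : Fin k → ℝ} {f : ∀ j, M j → V j}
    {u : ∀ j, N j → U j} {g : ∀ j, M j → N j} {B : ∀ j, U j →ₗᵢ[ℝ] V j}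
    (h : ∀ j x, c j • f j x = d j • B j (u j (g j x))) (x : ∀ j, M j) :
    productMap c f x = piLpIsometry B (productMap d u (Pi.map g x)) := by
  ext j
  simp [productMap, piLpIsometry, h]

lemma exists_isometry_smul_eq {U V : Type*} [NormedAddCommGroup U] [InnerProductSpace ℝ U]
    [NormedAddCommGroup V] [InnerProductSpace ℝ V] (A : U →ₗᵢ[ℝ] V) (c : ℝ) :
    ∃ B : U →ₗᵢ[ℝ] V, ∀ u, c • A u = |c| • B u := by
  rcases abs_cases c with ⟨h, -⟩ | ⟨h, -⟩
  · exact ⟨A, fun u => by rw [h]⟩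
  · exact ⟨(LinearIsometryEquiv.neg ℝ).toLinearIsometry.comp A, fun u => by rw [h]; simp⟩

variable {n : Fin k → ℕ} {M : Fin k → Type*} [∀ j, TopologicalSpace (M j)]
  [∀ j, ChartedSpace (EuclideanSpace ℝ (Fin (n j))) (M j)] [∀ j, IsManifold (𝓡 (n j)) ∞ (M j)]
  [∀ j, FiniteDimensional ℝ (V j)] {f : ∀ j, M j → V j} {c : Fin k → ℝ}

lemma exists_eq_clifford [∀ j, ConnectedSpace (M j)]
    (hf : ∀ j, IsMinimalInSphere (𝓡 (n j)) (f j))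
    (hn : ∀ j, 0 < n j) (hc : IsMinimalProduct n c f)
    (hS : ∀ j x, sqNormSFF (𝓡 (n j)) (f j) x = 0) :
    ∃ (A : PiLp 2 (fun j => EuclideanSpace ℝ (Fin (n j + 1))) →ₗᵢ[ℝ] PiLp 2 V)
      (B : ∀ j, EuclideanSpace ℝ (Fin (n j + 1)) →ₗᵢ[ℝ] V j)
      (g : ∀ j, M j → Metric.sphere (0 : EuclideanSpace ℝ (Fin (n j + 1))) 1),
      (∀ j, IsLocalDiffeomorph (𝓡 (n j)) (𝓡 (n j)) ∞ (g j)) ∧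
      (∀ j x, f j x = B j (g j x)) ∧
      ∀ x, productMap c f x = A (clifford n (Pi.map g x)) := by
  choose A g hg hA using fun j => exists_isLocalDiffeomorph_sphere (hf j) (hS j)
  choose B hB using fun j => exists_isometry_smul_eq (A j) (c j)
  refine ⟨piLpIsometry B, A, g, hg, hA, productMap_eq_piLpIsometry fun j x => ?_⟩
  rw [hA, hB, ← sq_coeff_eq hf hn hc j, Real.sqrt_sq_eq_abs]

lemma imageCongruent_clifford [∀ j, ConnectedSpace (M j)] [∀ j, CompactSpace (M j)]
    (hf : ∀ j, IsMinimalInSphere (𝓡 (n j)) (f j))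
    (hn : ∀ j, 0 < n j) (hc : IsMinimalProduct n c f)
    (hS : ∀ j x, sqNormSFF (𝓡 (n j)) (f j) x = 0) :
    ImageCongruent (productMap c f) (clifford n) := by
  obtain ⟨A, -, g, hg, -, h⟩ := exists_eq_clifford hf hn hc hS
  refine ⟨A, ?_⟩
  have hsurj : Function.Surjective (Pi.map g) :=
    Function.Surjective.piMap fun j => surjective_of_isLocalDiffeomorph_sphere (hn j) (hg j)
  rw [← Set.range_comp, ← hsurj.range_comp]
  exact congrArg Set.range (funext h)

lemma congruent_clifford [∀ j, ConnectedSpace (M j)] [∀ j, CompactSpace (M j)]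
    [∀ j, T2Space (M j)] (hf : ∀ j, IsMinimalInSphere (𝓡 (n j)) (f j))
    (hn : ∀ j, 0 < n j) (hc : IsMinimalProduct n c f)
    (hS : ∀ j x, sqNormSFF (𝓡 (n j)) (f j) x = 0)
    (hinj : ∀ j, n j = 1 → Function.Injective (f j)) :
    Congruent (prodModel n) (prodModel n) (productMap c f) (clifford n) := by
  obtain ⟨A, B, g, hg, hB, h⟩ := exists_eq_clifford hf hn hc hS
  have hgi (j) : Function.Injective (g j) := by
    rcases (Nat.succ_le_of_lt (hn j)).lt_or_eq with h1 | h1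
    · exact injective_of_isLocalDiffeomorph_sphere (by omega) (hg j)
    · exact fun x y hxy => hinj j h1.symm (by rw [hB, hB, hxy])
  refine ⟨A, piDiffeomorph fun j => (hg j).diffeomorphOfBijective
    ⟨hgi j, surjective_of_isLocalDiffeomorph_sphere (hn j) (hg j)⟩, fun x => ?_⟩
  exact h x

lemma Congruent.imageCongruent {E E' H H' M N V W : Type*}
    [NormedAddCommGroup V] [InnerProductSpace ℝ V] [NormedAddCommGroup W] [InnerProductSpace ℝ W]
    [NormedAddCommGroup E] [NormedSpace ℝ E] [NormedAddCommGroup E'] [NormedSpace ℝ E']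
    [TopologicalSpace H] {I : ModelWithCorners ℝ E H}
    [TopologicalSpace H'] {J : ModelWithCorners ℝ E' H'}
    [TopologicalSpace M] [ChartedSpace H M] [TopologicalSpace N] [ChartedSpace H' N]
    {f : M → V} {g : N → W} (h : Congruent I J f g) : ImageCongruent f g := by
  obtain ⟨A, φ, hφ⟩ := h
  refine ⟨A, ?_⟩
  rw [← Set.range_comp, ← φ.surjective.range_comp]
  exact congrArg Set.range (funext hφ)

/-- If the image of a minimal product is congruent to a Clifford submanifold, then the factors
are totally geodesic. -/
lemma sqNormSFF_eq_zero_of_imageCongruent [∀ j, Nonempty (M j)]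
    (hf : ∀ j, IsMinimalInSphere (𝓡 (n j)) (f j))
    (hn : ∀ j, 0 < n j) (hc : ∀ j, c j ≠ 0)
    (h : ImageCongruent (productMap c f) (clifford n)) (j : Fin k) (x : M j) :
    sqNormSFF (𝓡 (n j)) (f j) x = 0 := by
  classical
  obtain ⟨A, hA⟩ := h
  set L : (∀ j, V j) ≃ₗ[ℝ] PiLp 2 V := (WithLp.linearEquiv 2 ℝ (∀ j, V j)).symm
  set R : Submodule ℝ (∀ j, V j) := (LinearMap.range A.toLinearMap).comap L.toLinearMap
  have hR : Module.finrank ℝ R = ∑ j, (n j + 1) := by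
    have h1 : Module.finrank ℝ R = Module.finrank ℝ (LinearMap.range A.toLinearMap) :=
      (L.ofSubmodule' _).finrank_eq
    rw [h1, LinearMap.finrank_range_of_inj A.injective]
    have h2 := (WithLp.linearEquiv 2 ℝ (∀ j, EuclideanSpace ℝ (Fin (n j + 1)))).finrank_eq
    rw [Module.finrank_pi_fintype] at h2
    simpa using h2
  have hmem (x : ∀ j, M j) : (fun j => c j • f j (x j)) ∈ R := by
    have : productMap c f x ∈ A '' Set.range (clifford n) := hA ▸ Set.mem_range_self x
    obtain ⟨w, -, hw⟩ := this
    exact ⟨w, hw⟩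
  set W : ∀ j, Submodule ℝ (V j) := fun j => R.comap (LinearMap.single ℝ V j)
  have hW (j) (y : M j) : f j y ∈ W j := by
    refine mem_of_forall_sub_mem (hf j) (by simpa using (hn j).ne') (fun a b => ?_) y
    obtain ⟨x⟩ := (inferInstance : Nonempty (∀ j, M j))
    have h1 := R.sub_mem (hmem (Function.update x j a)) (hmem (Function.update x j b))
    refine (Submodule.smul_mem_iff (W j) (hc j)).1 ?_
    change Pi.single j (c j • (f j a - f j b)) ∈ R
    convert h1 using 1
    ext i
    rcases eq_or_ne i j with rfl | hij
    · simp [smul_sub]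
    · simp [hij]
  have hWd (j) : n j + 1 ≤ Module.finrank ℝ (W j) := by
    obtain ⟨y⟩ := (inferInstance : Nonempty (M j))
    have h1 := finrank_linearHull (hf j) y
    rw [finrank_euclideanSpace_fin] at h1
    exact h1 ▸ Submodule.finrank_mono (linearHull_le (hW j) y)
  have hsum : ∑ j, Module.finrank ℝ (W j) ≤ ∑ j, (n j + 1) := by
    rw [← hR, ← Module.finrank_pi_fintype]
    have hle (w : ∀ j, W j) : (fun j => (w j : V j)) ∈ R := by
      rw [← Finset.univ_sum_single (fun j => (w j : V j))]
      exact Submodule.sum_mem _ fun j _ => (w j).2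
    refine LinearMap.finrank_le_finrank_of_injective (f := LinearMap.codRestrict R
      (LinearMap.pi fun j => (W j).subtype ∘ₗ LinearMap.proj j) hle) ?_
    intro v w hvw
    have := congrArg Subtype.val hvw
    exact funext fun j => Subtype.ext (congrFun this j)
  refine sqNormSFF_eq_zero_of_mem (hf j) (hW j) ?_ x
  have heq := (Finset.sum_eq_sum_iff_of_le fun j _ => hWd j).1
    (le_antisymm (Finset.sum_le_sum fun j _ => hWd j) hsum) j (Finset.mem_univ j)
  rw [← heq, finrank_euclideanSpace_fin]

end Congruence

section Averages

lemma average_smul_measure {α : Type*} [MeasurableSpace α] (μ : Measure α) (g : α → ℝ) {t : ℝ≥0∞}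
    (ht : t ≠ 0) (ht' : t ≠ ⊤) : ⨍ x, g x ∂(t • μ) = ⨍ x, g x ∂μ := by
  have h : t.toReal ≠ 0 := ENNReal.toReal_ne_zero.2 ⟨ht, ht'⟩
  rw [average_eq, average_eq, integral_smul_measure, measureReal_ennreal_smul_apply, smul_smul,
    mul_inv, mul_comm t.toReal⁻¹, mul_assoc, inv_mul_cancel₀ h, mul_one]

/-- The average over a product of a function of one coordinate. -/
lemma average_pi_comp_eval {ι : Type*} [Fintype ι] {X : ι → Type*} [∀ i, MeasurableSpace (X i)]
    (μ : ∀ i, Measure (X i)) [∀ i, IsFiniteMeasure (μ i)] (hμ : ∀ i, μ i ≠ 0) (i : ι)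
    {g : X i → ℝ} (hg : AEStronglyMeasurable g (μ i)) :
    ⨍ x, g (x i) ∂Measure.pi μ = ⨍ y, g y ∂μ i := by
  classical
  have hmap := Measure.pi_map_eval μ i
  have hne : ∏ j ∈ Finset.univ.erase i, μ j Set.univ ≠ 0 :=
    Finset.prod_ne_zero_iff.2 fun j _ => by simpa using hμ j
  have hne' : ∏ j ∈ Finset.univ.erase i, μ j Set.univ ≠ ⊤ :=
    ENNReal.prod_ne_top fun j _ => measure_ne_top _ _
  rw [← average_smul_measure (μ i) g hne hne', ← hmap, average_eq, average_eq,
    integral_map (measurable_pi_apply i).aemeasurable, map_measureReal_apply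
      (measurable_pi_apply i) MeasurableSet.univ, Set.preimage_univ]
  change AEStronglyMeasurable g ((Measure.pi μ).map (Function.eval i))
  rw [hmap]
  exact hg.mono_ac Measure.smul_absolutelyContinuous

end Averages

section Curvature

variable {k : ℕ} {n : Fin k → ℕ} {M V : Fin k → Type*} [∀ j, TopologicalSpace (M j)]
  [∀ j, ChartedSpace (EuclideanSpace ℝ (Fin (n j))) (M j)]
  [∀ j, IsManifold (𝓡 (n j)) ∞ (M j)] [∀ j, Nonempty (M j)]
  [∀ j, NormedAddCommGroup (V j)] [∀ j, InnerProductSpace ℝ (V j)]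
  [∀ j, FiniteDimensional ℝ (V j)] {c : Fin k → ℝ} {f : ∀ j, M j → V j}

lemma continuous_sqNormSFF_productMap (hf : ∀ j, IsMinimalInSphere (𝓡 (n j)) (f j))
    (hn : ∀ j, 0 < n j) (hc : IsMinimalProduct n c f) :
    Continuous (sqNormSFF (prodModel n) (productMap c f)) := by
  rw [funext (sqNormSFF_productMap hf hn hc)]
  exact continuous_const.add (continuous_finsetSum _ fun j _ =>
    continuous_const.mul ((hf j).continuous_sqNormSFF.comp (continuous_apply j)))

lemma le_sqNormSFF_productMap (hf : ∀ j, IsMinimalInSphere (𝓡 (n j)) (f j))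
    (hn : ∀ j, 0 < n j) (hc : IsMinimalProduct n c f) (x : ∀ j, M j) :
    (k - 1) * ((∑ l, n l : ℕ) : ℝ) ≤ sqNormSFF (prodModel n) (productMap c f) x := by
  rw [sqNormSFF_productMap hf hn hc]
  exact le_add_of_nonneg_right (Finset.sum_nonneg fun j _ =>
    mul_nonneg (by positivity) (sqNormSFF_nonneg _ _))

lemma forall_sqNormSFF_productMap_eq_iff (hf : ∀ j, IsMinimalInSphere (𝓡 (n j)) (f j))
    (hn : ∀ j, 0 < n j) (hc : IsMinimalProduct n c f) :
    (∀ x, sqNormSFF (prodModel n) (productMap c f) x = (k - 1) * ((∑ l, n l : ℕ) : ℝ)) ↔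
      ∀ j y, sqNormSFF (𝓡 (n j)) (f j) y = 0 := by
  simp only [sqNormSFF_productMap hf hn hc, add_eq_left]
  refine ⟨fun h j y => ?_, fun h x => Finset.sum_eq_zero fun j _ => by rw [h, mul_zero]⟩
  obtain ⟨x⟩ := (inferInstance : Nonempty (∀ j, M j))
  have h1 := (Finset.sum_eq_zero_iff_of_nonneg fun j _ =>
    mul_nonneg (by positivity) (sqNormSFF_nonneg _ _)).1 (h (Function.update x j y)) j
    (Finset.mem_univ j)
  have hN : 0 < ∑ l, n l := Finset.sum_pos (fun l _ => hn l) ⟨j, Finset.mem_univ j⟩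
  rw [Function.update_self, mul_eq_zero] at h1
  refine h1.resolve_left (div_ne_zero ?_ ?_)
  · exact_mod_cast hN.ne'
  · exact_mod_cast (hn j).ne'

end Curvature

/-- For a continuous function `S` bounded below by a positive constant `K`, the weighted integral
of `S - K` vanishes only if `S` is constant. -/
lemma integral_rpow_mul_sub_eq_zero_iff {X : Type*} [TopologicalSpace X] [CompactSpace X]
    [MeasurableSpace X] [BorelSpace X] {μ : Measure X} [IsFiniteMeasure μ] [μ.IsOpenPosMeasure]
    {S : X → ℝ} (hS : Continuous S) {K : ℝ} (hK : 0 < K) (hSK : ∀ x, K ≤ S x) (a : ℝ) :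
    Integrable (fun x => S x ^ a * (S x - K)) μ ∧ 0 ≤ ∫ x, S x ^ a * (S x - K) ∂μ ∧
      ((∫ x, S x ^ a * (S x - K) ∂μ) = 0 ↔ ∀ x, S x = K) := by
  have hpos (x) : 0 < S x ^ a := Real.rpow_pos_of_pos (hK.trans_le (hSK x)) a
  have hcont : Continuous fun x => S x ^ a * (S x - K) :=
    (hS.rpow_const fun x => Or.inl (hK.trans_le (hSK x)).ne').mul (hS.sub continuous_const)
  have hintegrable : Integrable (fun x => S x ^ a * (S x - K)) μ :=
    hcont.integrable_of_hasCompactSupport (HasCompactSupport.of_compactSpace _)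
  have hnn (x) : 0 ≤ S x ^ a * (S x - K) := mul_nonneg (hpos x).le (sub_nonneg.2 (hSK x))
  refine ⟨hintegrable, integral_nonneg hnn, ?_⟩
  rw [integral_eq_zero_iff_of_nonneg hnn hintegrable, hcont.ae_eq_iff_eq μ continuous_zero, funext_iff]
  refine forall_congr' fun x => ?_
  simp [(hpos x).ne', sub_eq_zero]

end MinimalProduct

end

theorem theorem5p1 {k : ℕ} (hk : 2 ≤ k) (n p : Fin k → ℕ) (hn : ∀ j, 0 < n j)
    (M : Fin k → Type*) [∀ j, TopologicalSpace (M j)] [∀ j, T2Space (M j)]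
    [∀ j, CompactSpace (M j)] [∀ j, ConnectedSpace (M j)]
    [∀ j, MeasurableSpace (M j)] [∀ j, BorelSpace (M j)]
    [∀ j, ChartedSpace (EuclideanSpace ℝ (Fin (n j))) (M j)]
    [∀ j, IsManifold (𝓡 (n j)) ∞ (M j)]
    (f : ∀ j, M j → EuclideanSpace ℝ (Fin (n j + p j + 1)))
    (hf : ∀ j, IsMinimalInSphere (𝓡 (n j)) (f j))
    (c : Fin k → ℝ) (hc : IsMinimalProduct n c f) :
    let F := productMap c f
    let N : ℝ := ((∑ j, n j : ℕ) : ℝ)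
    let dM : Measure (∀ j, M j) := inducedVolume (prodModel n) F
    let S : (∀ j, M j) → ℝ := sqNormSFF (prodModel n) F
    let dMj : ∀ j, Measure (M j) := fun j => inducedVolume (𝓡 (n j)) (f j)
    let Sj : ∀ j, M j → ℝ := fun j => sqNormSFF (𝓡 (n j)) (f j)
    -- the volumes are positive and finite, and the functions below are integrable
    (0 < dM Set.univ ∧ dM Set.univ < ⊤ ∧ Integrable S dM) ∧
    (∀ j, 0 < dMj j Set.univ ∧ dMj j Set.univ < ⊤ ∧ Integrable (Sj j) (dMj j)) ∧
    (∀ a : ℝ, Integrable (fun x => S x ^ a * (S x - (k - 1) * N)) dM) ∧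
    -- the inequality, and the formula and the estimate for the average of `S`
    (∀ a : ℝ, 0 ≤ ∫ x, S x ^ a * (S x - (k - 1) * N) ∂dM) ∧
    (⨍ x, S x ∂dM) = N * ((k - 1) + ∑ j, (⨍ x, Sj j x ∂dMj j) / n j) ∧
    (k - 1) * N ≤ ⨍ x, S x ∂dM ∧
    -- the cases of equality
    (∀ a : ℝ, (∫ x, S x ^ a * (S x - (k - 1) * N) ∂dM) = 0 ↔
      ImageCongruent F (clifford n)) ∧
    ((⨍ x, S x ∂dM) = (k - 1) * N ↔ ImageCongruent F (clifford n)) ∧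
    -- if no circle factor is multiply covered, congruence holds for the immersions themselves
    ((∀ j, n j = 1 → Function.Injective (f j)) →
      (∀ a : ℝ, (∫ x, S x ^ a * (S x - (k - 1) * N) ∂dM) = 0 ↔
        Congruent (prodModel n) (prodModel n) F (clifford n)) ∧
      ((⨍ x, S x ∂dM) = (k - 1) * N ↔
        Congruent (prodModel n) (prodModel n) F (clifford n))) := by
  intro F N dM S dMj Sj
  have hsc (j) : SecondCountableTopology (M j) :=
    ChartedSpace.secondCountable_of_sigmaCompact (EuclideanSpace ℝ (Fin (n j))) (M j)
  have hfin (j) : IsFiniteMeasure (dMj j) := isFiniteMeasure_inducedVolume (hf j).contMDiff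
  have hpos (j) : (dMj j).IsOpenPosMeasure :=
    isOpenPosMeasure_inducedVolume (hf j).contMDiff (hf j).immersion
  have hdM : dM = Measure.pi fun j => ‖c j‖₊ ^ n j • dMj j :=
    inducedVolume_productMap fun j => (hf j).contMDiff
  have hcn (j) : ((‖c j‖₊ ^ n j : NNReal) : ENNReal) ≠ 0 := by
    simpa using fun h => absurd h (hc.ne_zero j)
  have hpos' (j) : (‖c j‖₊ ^ n j • dMj j).IsOpenPosMeasure :=
    Measure.isOpenPosMeasure_smul (dMj j) (hcn j)
  have hdMfin : IsFiniteMeasure dM := by rw [hdM]; infer_instance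
  have hdMpos : dM.IsOpenPosMeasure := by rw [hdM]; infer_instance
  have hN : 0 < N := by
    have : 0 < ∑ l, n l := Finset.sum_pos (fun l _ => hn l) ⟨⟨0, by omega⟩, Finset.mem_univ _⟩
    exact Nat.cast_pos.2 this
  have hk1 : (1 : ℝ) < k := by exact_mod_cast hk
  have hK : 0 < (k - 1) * N := mul_pos (sub_pos.2 hk1) hN
  have hSc : Continuous S := continuous_sqNormSFF_productMap hf hn hc
  have hSK : ∀ x, (k - 1) * N ≤ S x := le_sqNormSFF_productMap hf hn hc
  have hSint : Integrable S dM :=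
    hSc.integrable_of_hasCompactSupport (HasCompactSupport.of_compactSpace _)
  have hSjc (j) : Continuous (Sj j) := (hf j).continuous_sqNormSFF
  have hSjint (j) : Integrable (Sj j) (dMj j) :=
    (hSjc j).integrable_of_hasCompactSupport (HasCompactSupport.of_compactSpace _)
  have hmain (a : ℝ) := integral_rpow_mul_sub_eq_zero_iff (μ := dM) hSc hK hSK a
  have hS0 : (∀ x, S x = (k - 1) * N) ↔ ∀ j y, Sj j y = 0 :=
    forall_sqNormSFF_productMap_eq_iff hf hn hc
  have hvol : 0 < dM.real Set.univ :=
    ENNReal.toReal_pos (isOpen_univ.measure_pos dM Set.univ_nonempty).ne' (measure_ne_top _ _)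
  have hconst : ⨍ _, (k - 1) * N ∂dM = (k - 1) * N := by
    rw [average_eq, integral_const, smul_smul, inv_mul_cancel₀ hvol.ne', one_smul]
  have havg : (⨍ x, S x ∂dM) = (k - 1) * N ↔ ∀ x, S x = (k - 1) * N := by
    rw [← (hmain 0).2.2]
    simp only [Real.rpow_zero, one_mul]
    rw [integral_sub hSint (integrable_const _), integral_const, average_eq, smul_eq_mul,
      smul_eq_mul, inv_mul_eq_iff_eq_mul₀ hvol.ne', sub_eq_zero]
  have hformula : (⨍ x, S x ∂dM) = N * ((k - 1) + ∑ j, (⨍ x, Sj j x ∂dMj j) / n j) := by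
    have havj (j) : ⨍ x, Sj j (x j) ∂dM = ⨍ y, Sj j y ∂dMj j := by
      rw [hdM, average_pi_comp_eval _ (fun i h => ?_) j
        (hSjc j).aestronglyMeasurable]
      · exact MinimalProduct.average_smul_measure (dMj j) (Sj j) (hcn j) ENNReal.coe_ne_top
      · have := (isOpen_univ (X := M i)).measure_pos (‖c i‖₊ ^ n i • dMj i) Set.univ_nonempty
        simp [h] at this
    have hintegrable (j) : Integrable (fun x : ∀ j, M j => N / n j * Sj j (x j)) dM :=
      ((hSjc j).comp (continuous_apply j)).integrable_of_hasCompactSupport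
        (HasCompactSupport.of_compactSpace _) |>.const_mul _
    have hS : S = fun x => (k - 1) * N + ∑ j, N / n j * Sj j (x j) :=
      funext (sqNormSFF_productMap hf hn hc)
    rw [hS, average_eq, integral_add (integrable_const _)
      (integrable_finsetSum _ fun j _ => hintegrable j), integral_finsetSum _ fun j _ => hintegrable j,
      smul_add, ← average_eq, hconst, Finset.smul_sum,
      mul_add, Finset.mul_sum, mul_comm N]
    congr 1
    refine Finset.sum_congr rfl fun j _ => ?_
    rw [integral_const_mul, smul_eq_mul, mul_left_comm, ← smul_eq_mul (dM.real Set.univ)⁻¹,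
      ← average_eq, havj]
    ring
  have himage : (∀ x, S x = (k - 1) * N) ↔ ImageCongruent F (clifford n) := by
    rw [hS0]
    exact ⟨imageCongruent_clifford hf hn hc,
      sqNormSFF_eq_zero_of_imageCongruent hf hn hc.ne_zero⟩
  refine ⟨⟨isOpen_univ.measure_pos dM Set.univ_nonempty, measure_lt_top _ _, hSint⟩,
    fun j => ⟨isOpen_univ.measure_pos (dMj j) Set.univ_nonempty, measure_lt_top _ _, hSjint j⟩,
    fun a => (hmain a).1, fun a => (hmain a).2.1, hformula, ?_,
    fun a => (hmain a).2.2.trans himage, havg.trans himage, fun hinj => ?_⟩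
  · rw [hformula, mul_comm N]
    refine mul_le_mul_of_nonneg_right (le_add_of_nonneg_right (Finset.sum_nonneg fun j _ => ?_))
      hN.le
    refine div_nonneg ?_ (Nat.cast_nonneg _)
    rw [average_eq]
    exact smul_nonneg (by positivity) (integral_nonneg fun y => sqNormSFF_nonneg _ _)
  · have hcong : (∀ x, S x = (k - 1) * N) ↔
        Congruent (prodModel n) (prodModel n) F (clifford n) :=
      ⟨fun h => congruent_clifford hf hn hc (hS0.1 h) hinj, fun h => himage.2 h.imageCongruent⟩
    exact ⟨fun a => (hmain a).2.2.trans hcong, havg.trans hcong⟩
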